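/- Let $R$ be a commutative ring, let $a,b\in R$, and put $\Delta=-2^4(4a^3+27b^2)$, the discriminant of the curve $Y^2=X^3+aX+b$. Let $f_n\in R[X]$ ($n\ge 0$) be its division polynomials, normalised by $$f_0=0,\quad f_1=f_2=1,\quad f_3=3X^4+6aX^2+12bX-a^2,$$ $$f_4=2X^6+10aX^4+40bX^3-10a^2X^2-8abX-2a^3-16b^2,$$ $$f_{2n}=f_n\,(f_{n+2}f_{n-1}^2-f_{n-2}f_{n+1}^2)\quad(n\ge 3),$$ $$f_{2n+1}=\begin{cases} f_{n+2}f_n^3-16(X^3+aX+b)^2 f_{n+1}^3f_{n-1} & (n\ge 3 \text{ odd}),\\ 16(X^3+aX+b)^2 f_{n+2}f_n^3-f_{n+1}^3f_{n-1} & (n\ge 2\text{ even}).\end{cases}$$ For a polynomial $f$ of degree $d\geq 1$ with leading coefficient $c$, let $\mathrm{Disc}(f)$ be its usual discriminant, that is, the value at the coefficients of $f$ of the universal integer polynomial determined by $c\cdot\mathrm{Disc}(f)=(-1)^{d(d-1)/2}\,\mathrm{Res}(f,f')$. Let $m$ be a positive integer whose image in $R$ is nonzero (automatic if $R$ is a field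 of characteristic $0$). Then $$\mathrm{Disc}(f_m)=\begin{cases} 2^4\, m^{(m^2-12)/2}\,(-\Delta)^{(m^2-4)(m^2-6)/24} & \text{if } m \text{ is even and } m\ge 4,\\[2pt] (-1)^{(m-1)/2}\, m^{(m^2-3)/2}\,(-\Delta)^{(m^2-1)(m^2-3)/24} & \text{if } m\text{ is odd and } m\ge 3,\end{cases}$$ where all the exponents are nonnegative integers. -/

import Mathlib

open Polynomial

/-- The curve `Y² = X³ + a X + b`. -/
def shortCurve {R : Type*} [CommRing R] (a b : R) : WeierstrassCurve R :=
  { a₁ := 0, a₂ := 0, a₃ := 0, a₄ := a, a₆ := b }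

/-- The univariate `n`-th division polynomial `fₙ` of `Y² = X³ + a X + b`: for odd `n` it is `ψₙ`,
for even `n` it is `ψₙ / ψ₂` with `ψ₂ = 2Y`; so `f₁ = f₂ = 1`. -/
noncomputable def divisionPoly {R : Type*} [CommRing R] (a b : R) (n : ℕ) : R[X] :=
  (shortCurve a b).preΨ' n

/-- The discriminant of the curve, in the usual closed form. -/
theorem shortCurve_disc {R : Type*} [CommRing R] (a b : R) :
    (shortCurve a b).Δ = -2 ^ 4 * (4 * a ^ 3 + 27 * b ^ 2) := by
  simp only [shortCurve, WeierstrassCurve.Δ, WeierstrassCurve.b₂, WeierstrassCurve.b₄,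
    WeierstrassCurve.b₆, WeierstrassCurve.b₈]
  ring

/-! The discriminant of `f_m` is, up to sign and leading coefficient, the product of `f_m'` over the
roots of `f_m`. At such a root, `ψ₂² f_{m+1} f_m' = m f_{m+2} f_{m-1}`, so everything reduces to
resultants of `f_m` with `ψ₂²` and with nearby division polynomials.

Two identities carry this. One is the Somos-4 invariant `f_{k+4} f_{k+1}² + f_k f_{k+3}² + (parity
weight) f_{k+2}³ = (6X² + 2a) f_{k+1} f_{k+2} f_{k+3}`; the other expresses that multiplication by
`m` multiplies the invariant differential `dx/2y` by `m`. Both rest on `x(nP) - x(mP) = ψ_{m+n}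
ψ_{m-n} / (ψ_m ψ_n)²`, which is derived from the defining recursion alone (the cases `m - n = 1,
2`), without the group law.

Modulo one `f_m`, the invariant becomes a recursion between resultants of neighbours, solved by
powers of `-Δ`. The resultant with `ψ₂²` comes from the values of `f_m` at the points of order two.

All this takes place over an algebraically closed field of characteristic 0 with `Δ ≠ 0`. The
formula thus holds over `ℤ[A, B]`, and it specialises to any `R` with `m ≠ 0`, because the degree of
`f_m` does not drop. -/

/-! ### Addition formulas from duplication formulas. -/

/-- The abscissa differences `q n = x(P) - x(nP)` determine the ratios
`r m n = ψₘ₊ₙ ψₘ₋ₙ / (ψₘ ψₙ)²`: the duplication formulas imply all the addition formulas, together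
with the product and the sum of `q (k + 2)` and `q k`. -/
theorem ratio_eq_sub_of_duplication {L : Type*} [Field L] {s c C : L} (q : ℕ → L) (r : ℕ → ℕ → L)
    (q1 : q 1 = 0) (q2 : s * q 2 = c)
    (sum2 : q 2 ^ 2 * (q 3 + q 1) = C * q 2 - s)
    (hq0 : ∀ n, q (n + 2) ≠ 0) (hr0 : ∀ m n, 1 ≤ n → n < m → r m n ≠ 0)
    (hr1 : ∀ m, 2 ≤ m → r m 1 = q m)
    (hr2 : ∀ k, s * r (k + 3) 2 = q (k + 4) * q (k + 3) ^ 2 * q (k + 2))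
    (hr : ∀ k n, 1 ≤ n → n + 1 < k → r (k + 1) (n + 2) * r (k + 1) n * q (n + 1) ^ 2 =
      r (k + 2) (n + 1) * r k (n + 1) * q (k + 1) ^ 2)
    (hodd : ∀ j, 1 ≤ j → r (j + 1) j = q (j + 1) - q j)
    (heven : ∀ j, 1 ≤ j → r (j + 2) j = q (j + 2) - q j) :
    (∀ k, q (k + 3) * q (k + 1) * q (k + 2) ^ 2 = s * q (k + 2) - c) ∧
      ∀ k, q (k + 2) ^ 2 * (q (k + 3) + q (k + 1)) = C * q (k + 2) - s := by
  have prod_of (k : ℕ) (h : 1 ≤ k → r (k + 2) 2 = q (k + 2) - q 2) :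
      q (k + 3) * q (k + 1) * q (k + 2) ^ 2 = s * q (k + 2) - c := by
    rcases k with _ | k
    · simp [q1, q2]
    · have h1 := hr2 k
      rw [show k + 1 + 2 = k + 3 by ring] at h
      rw [h (by lia)] at h1
      linear_combination -h1 - q2
  have sum_of (k : ℕ) (h : ∀ i, i ≤ k → q (i + 3) * q (i + 1) * q (i + 2) ^ 2 = s * q (i + 2) - c) :
      q (k + 2) ^ 2 * (q (k + 3) + q (k + 1)) = C * q (k + 2) - s := by
    induction k with
    | zero => exact sum2
    | succ k ih =>
      have ih := ih fun i hi => h i (by lia)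
      have h0 := h k (by lia)
      have h1 := h (k + 1) le_rfl
      simp only [show k + 1 + 1 = k + 2 by ring, show k + 1 + 2 = k + 3 by ring,
        show k + 1 + 3 = k + 4 by ring] at *
      have hk := hq0 k
      -- Subtracting consecutive product formulas and using the previous sum formula leaves `q (k +
      -- 2)` times the new one.
      refine mul_left_cancel₀ hk ?_
      linear_combination h1 - h0 + q (k + 3) * ih
  have key : ∀ N m n, 1 ≤ n → n < m → m + n = N → r m n = q m - q n := by
    intro N
    induction N using Nat.strong_induction_on with
    | _ N IH =>
      have P (k : ℕ) (hk : k + 4 < N) : q (k + 3) * q (k + 1) * q (k + 2) ^ 2 = s * q (k + 2) - c :=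
        prod_of k fun hk' => IH (k + 4) hk _ _ (by lia) (by lia) rfl
      have S (k : ℕ) (hk : k + 4 < N) :
          q (k + 2) ^ 2 * (q (k + 3) + q (k + 1)) = C * q (k + 2) - s :=
        sum_of k fun i hi => P i (by lia)
      have main (δ : ℕ) : ∀ m n, 1 ≤ n → m = n + δ + 1 → m + n = N → r m n = q m - q n := by
        induction δ using Nat.strong_induction_on with
        | _ δ ihδ =>
          rintro m n hn rfl hN
          match δ, ihδ with
          | 0, _ => exact hodd n hn
          | 1, _ => exact heven n hn
          | δ + 2, ihδ =>
            obtain rfl | ⟨n, rfl⟩ : n = 1 ∨ ∃ i, n = i + 2 :=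
              (lt_or_eq_of_le hn).elim (fun h => .inr ⟨n - 2, by lia⟩) (fun h => .inl h.symm)
            · rw [hr1 _ (by lia), q1, sub_zero]
            · have h1 := hr (n + δ + 3) (n + 1) (by lia) (by lia)
              have h2 := ihδ δ (by lia) (n + δ + 4) (n + 3) (by lia) (by lia) (by lia)
              have h3 := IH (N - 2) (by lia) (n + δ + 4) (n + 1) (by lia) (by lia) (by lia)
              have h4 := IH (N - 2) (by lia) (n + δ + 3) (n + 2) (by lia) (by lia) (by lia)
              have n4 := hr0 (n + δ + 3) (n + 2) (by lia) (by lia)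
              have nq := hq0 (n + δ + 2)
              have P1 := P n (by lia)
              have S1 := S n (by lia)
              have P2 := P (n + δ + 2) (by lia)
              have S2 := S (n + δ + 2) (by lia)
              simp only [show n + 2 + (δ + 2) + 1 = n + δ + 5 by ring,
                show n + δ + 3 + 1 = n + δ + 4 by ring, show n + δ + 3 + 2 = n + δ + 5 by ring,
                show n + δ + 2 + 1 = n + δ + 3 by ring,
                show n + 1 + 1 = n + 2 by ring, show n + 1 + 2 = n + 3 by ring] at *
              -- With `p = q (n + 2)` and `Y = q (n + δ + 4)`, the product and sum formulas turn `p²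
              -- (Y - q (n + 1)) (Y - q (n + 3))` into `p² Y² - C p Y + s (p + Y) - c`. This is
              -- symmetric in `p` and `Y`, so it also equals `Y² (p - q (n + δ + 3)) (p - q (n + δ +
              -- 5))`.
              refine mul_right_cancel₀ n4 (mul_right_cancel₀ (pow_ne_zero 2 nq) ?_)
              rw [← h1, h2, h3, h4]
              linear_combination -q (n + δ + 4) * S1 + P1 + q (n + 2) * S2 - P2
      intro m n hn hmn hN
      exact main (m - n - 1) m n hn (by lia) hN
  have P (k : ℕ) := prod_of k fun _ => key _ _ _ (by lia) (by lia) rfl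
  exact ⟨P, fun k => sum_of k fun i _ => P i⟩

/-! ### Abscissa differences of division polynomials. -/

/-- The square of `ψₙ / fₙ`, for `ψ₂² = s`. -/
def parityFactor {R : Type*} [One R] (s : R) (n : ℕ) : R := if Even n then s else 1

section parityFactor
variable {R S : Type*} [CommRing R] [CommRing S] (s : R)

@[simp] theorem parityFactor_zero : parityFactor s 0 = s := by simp [parityFactor]

@[simp] theorem parityFactor_one : parityFactor s 1 = 1 := by simp [parityFactor]

@[simp] theorem parityFactor_two : parityFactor s 2 = s := by simp [parityFactor]

theorem parityFactor_add_two (n : ℕ) : parityFactor s (n + 2) = parityFactor s n := by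
  simp [parityFactor, Nat.even_add]

theorem parityFactor_mul_succ (n : ℕ) : parityFactor s n * parityFactor s (n + 1) = s := by
  by_cases h : Even n <;> simp [parityFactor, h, Nat.even_add_one]

theorem map_parityFactor (φ : R →+* S) (n : ℕ) :
    φ (parityFactor s n) = parityFactor (φ s) n := by
  simp [parityFactor, apply_ite φ]

end parityFactor

/-- The difference `x(P) - x(nP)` of abscissas, as `ψₙ₊₁ ψₙ₋₁ / ψₙ²`. -/
noncomputable def xDiff {L : Type*} [Field L] (s c d : L) (n : ℕ) : L :=
  parityFactor s (n + 1) * preNormEDS' (s ^ 2) c d (n + 1) * preNormEDS' (s ^ 2) c d (n - 1) /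
    (parityFactor s n * preNormEDS' (s ^ 2) c d n ^ 2)

section xDiff
variable {L : Type*} [Field L] {s c d C : L}

theorem xDiff_succ (n : ℕ) : xDiff s c d (n + 1) =
    parityFactor s n * preNormEDS' (s ^ 2) c d (n + 2) * preNormEDS' (s ^ 2) c d n /
    (parityFactor s (n + 1) * preNormEDS' (s ^ 2) c d (n + 1) ^ 2) := by
  rw [xDiff, show n + 1 + 1 = n + 2 by ring, parityFactor_add_two, Nat.add_sub_cancel]

theorem xDiff_one : xDiff s c d 1 = 0 := by simp [xDiff]

theorem xDiff_two : xDiff s c d 2 = c / s := by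
  simp [xDiff, parityFactor, show ¬ Even 3 by decide]

theorem parityFactor_ne_zero (hs : s ≠ 0) (n : ℕ) : parityFactor s n ≠ 0 := by
  unfold parityFactor; split_ifs <;> simp [hs]

theorem xDiff_ne_zero (hs : s ≠ 0) (hf : ∀ n, preNormEDS' (s ^ 2) c d (n + 1) ≠ 0) (n : ℕ) :
    xDiff s c d (n + 2) ≠ 0 := by
  rw [xDiff_succ]
  have := parityFactor_ne_zero hs
  simp [hf, this]

/-- The squared weights put the factor `b ^ 2` on the correct term for either parity of `j`, which
merges the two cases of the recursion. -/
theorem preNormEDS'_odd_parityFactor (b c d : L) (j : ℕ) :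
    preNormEDS' (b ^ 2) c d (2 * j + 3) =
      parityFactor b (j + 1) ^ 2 * preNormEDS' (b ^ 2) c d (j + 3) *
          preNormEDS' (b ^ 2) c d (j + 1) ^ 3 -
        parityFactor b j ^ 2 * preNormEDS' (b ^ 2) c d (j + 2) ^ 3 *
          preNormEDS' (b ^ 2) c d j := by
  rcases j with _ | j
  · simp
  · rw [show 2 * (j + 1) + 3 = 2 * (j + 2) + 1 by ring, preNormEDS'_odd]
    simp only [show j + 1 + 3 = j + 4 by ring, show j + 1 + 2 = j + 3 by ring,
      show j + 1 + 1 = j + 2 by ring]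
    by_cases h : Even j <;> simp [parityFactor, h, Nat.even_add_one] <;> ring

theorem preNormEDS'_even_succ (b c d : L) (j : ℕ) :
    preNormEDS' b c d (2 * j + 4) = preNormEDS' b c d (j + 2) *
      (preNormEDS' b c d (j + 4) * preNormEDS' b c d (j + 1) ^ 2 -
        preNormEDS' b c d j * preNormEDS' b c d (j + 3) ^ 2) := by
  rcases j with _ | j
  · simp
  · rw [show 2 * (j + 1) + 4 = 2 * (j + 3) by ring, preNormEDS'_even]
    ring_nf

/-- The recursion enters only as the cases of difference one and two; `hd`, which fixes the fourth
term, gives the initial sum. The other conditions are nonvanishing or plain cancellation in the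
quotients. -/
theorem xDiff_relations (hs : s ≠ 0) (hf : ∀ n, preNormEDS' (s ^ 2) c d (n + 1) ≠ 0)
    (hd : d = C * c - s ^ 2) :
    (∀ k, xDiff s c d (k + 3) * xDiff s c d (k + 1) * xDiff s c d (k + 2) ^ 2 =
      s * xDiff s c d (k + 2) - c) ∧
    ∀ k, xDiff s c d (k + 2) ^ 2 * (xDiff s c d (k + 3) + xDiff s c d (k + 1)) =
      C * xDiff s c d (k + 2) - s := by
  have hp := parityFactor_ne_zero hs
  have hc : c ≠ 0 := by simpa using hf 2
  refine ratio_eq_sub_of_duplication _ (fun m n =>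
    parityFactor s (m + n) * preNormEDS' (s ^ 2) c d (m + n) * preNormEDS' (s ^ 2) c d (m - n) /
      (parityFactor s m * parityFactor s n * preNormEDS' (s ^ 2) c d m ^ 2 *
        preNormEDS' (s ^ 2) c d n ^ 2))
    xDiff_one ?_ ?_ (xDiff_ne_zero hs hf) ?_ ?_ ?_ ?_ ?_ ?_
  · rw [xDiff_two]; field_simp
  · rw [xDiff_one, xDiff_two, xDiff]
    simp only [Nat.reduceAdd, Nat.reduceSub, preNormEDS'_two, preNormEDS'_three, preNormEDS'_four,
      parityFactor, show Even 4 by decide, show ¬ Even 3 by decide, if_true, if_false, hd]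
    field_simp
    ring
  · intro m n hn hmn
    obtain ⟨n, rfl⟩ : ∃ i, n = i + 1 := ⟨n - 1, by lia⟩
    obtain ⟨j, rfl⟩ : ∃ i, m = n + 1 + (i + 1) := ⟨m - n - 2, by lia⟩
    have hf' (i : ℕ) (hi : 1 ≤ i) : preNormEDS' (s ^ 2) c d i ≠ 0 := by
      obtain ⟨i, rfl⟩ := Nat.exists_eq_add_of_le' hi
      exact hf i
    simp [hp, hf' (n + 1 + (j + 1) + (n + 1)) (by lia), hf' (j + 1) (by lia),
      hf' (n + 1 + (j + 1)) (by lia), hf' (n + 1) (by lia)]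
  · intro m hm
    simp [xDiff]
  · intro k
    rw [xDiff_succ, xDiff_succ, xDiff_succ]
    simp only [show k + 3 - 2 = k + 1 by lia, parityFactor_add_two, parityFactor_zero,
      preNormEDS'_two, show k + 1 + 2 = k + 3 by ring, show k + 2 + 2 = k + 4 by ring,
      show k + 3 + 2 = k + 5 by ring, show k + 1 + 1 = k + 2 by ring]
    have h1 := hf k
    have h2 := hf (k + 1)
    have h3 := hf (k + 2)
    have h4 := hf (k + 3)
    have p1 := hp k
    have p2 := hp (k + 1)
    field_simp
  · intro k n hn hk
    obtain ⟨n, rfl⟩ : ∃ i, n = i + 1 := ⟨n - 1, by lia⟩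
    obtain ⟨j, rfl⟩ : ∃ i, k = n + 3 + i := ⟨k - n - 3, by lia⟩
    simp only [xDiff_succ]
    simp only [show n + 3 + j + 1 + (n + 1 + 2) = 2 * n + j + 7 by ring,
      show n + 3 + j + 1 - (n + 1 + 2) = j + 1 by lia,
      show n + 3 + j + 1 + (n + 1) = 2 * n + j + 5 by ring,
      show n + 3 + j + 1 - (n + 1) = j + 3 by lia,
      show n + 3 + j + 2 + (n + 1 + 1) = 2 * n + j + 7 by ring,
      show n + 3 + j + 2 - (n + 1 + 1) = j + 3 by lia,
      show n + 3 + j + (n + 1 + 1) = 2 * n + j + 5 by ring,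
      show n + 3 + j - (n + 1 + 1) = j + 1 by lia, parityFactor_add_two]
    simp only [add_assoc, Nat.reduceAdd]
    have h1 := hf n
    have h2 := hf (n + 1)
    have h3 := hf (n + 2)
    have h4 : preNormEDS' (s ^ 2) c d (n + (3 + j)) ≠ 0 := by convert hf (n + (2 + j)) using 2; ring
    have h5 := hf (n + (3 + j))
    have h6 : preNormEDS' (s ^ 2) c d (n + (3 + (j + 2))) ≠ 0 := hf (n + (3 + (j + 1)))
    have p1 := hp n
    have p2 := hp (n + 1)
    have p4 := hp (n + (3 + j))
    have p5 := hp (n + (3 + (j + 1)))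
    simp only [add_assoc, Nat.reduceAdd] at *
    field_simp
  · intro j hj
    obtain ⟨j, rfl⟩ : ∃ i, j = i + 1 := ⟨j - 1, by lia⟩
    simp only [xDiff_succ]
    simp only [show j + 1 + 1 + (j + 1) = 2 * j + 3 by ring, show j + 1 + 1 - (j + 1) = 1 by lia,
      show j + 1 + 2 = j + 3 by ring, show j + 1 + 1 = j + 2 by ring, parityFactor_add_two,
      preNormEDS'_odd_parityFactor, preNormEDS'_one]
    have e : parityFactor s (2 * j + 1) = 1 := by
      simp [parityFactor]
    have e2 : parityFactor s (j + 1) = s / parityFactor s j := by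
      rw [eq_div_iff (hp j), mul_comm, parityFactor_mul_succ]
    have h1 := hf j
    have h2 := hf (j + 1)
    have p1 := hp j
    rw [e, e2]
    field_simp
  · intro j hj
    obtain ⟨j, rfl⟩ : ∃ i, j = i + 1 := ⟨j - 1, by lia⟩
    simp only [xDiff_succ]
    simp only [show j + 1 + 2 + (j + 1) = 2 * j + 4 by ring, show j + 1 + 2 - (j + 1) = 2 by lia,
      show j + 1 + 2 = j + 3 by ring, parityFactor_add_two,
      preNormEDS'_even_succ, preNormEDS'_two]
    have e : parityFactor s (2 * j) = s := by
      simp [parityFactor]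
    have e2 : parityFactor s (j + 1) = s / parityFactor s j := by
      rw [eq_div_iff (hp j), mul_comm, parityFactor_mul_succ]
    have h1 := hf j
    have h2 := hf (j + 2)
    have p1 := hp j
    rw [e, e2]
    simp only [add_assoc, Nat.reduceAdd] at *
    field_simp

end xDiff

/-! ### The Somos-4 invariant and the invariant differential. -/

section
variable {L : Type*} [Field L] {s c d C : L}

/-- The invariant of the Somos-4 recursion satisfied by division polynomials. -/
theorem preNormEDS'_invariant (hs : s ≠ 0) (hf : ∀ n, preNormEDS' (s ^ 2) c d (n + 1) ≠ 0)
    (hd : d = C * c - s ^ 2) (k : ℕ) :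
    preNormEDS' (s ^ 2) c d (k + 4) * preNormEDS' (s ^ 2) c d (k + 1) ^ 2 +
        preNormEDS' (s ^ 2) c d k * preNormEDS' (s ^ 2) c d (k + 3) ^ 2 +
        parityFactor s k ^ 2 * preNormEDS' (s ^ 2) c d (k + 2) ^ 3 =
      C * preNormEDS' (s ^ 2) c d (k + 1) * preNormEDS' (s ^ 2) c d (k + 2) *
        preNormEDS' (s ^ 2) c d (k + 3) := by
  have h := (xDiff_relations hs hf hd).2 k
  simp only [xDiff_succ, parityFactor_add_two] at h
  have e2 : parityFactor s (k + 1) = s / parityFactor s k := by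
    rw [eq_div_iff (parityFactor_ne_zero hs k), mul_comm, parityFactor_mul_succ]
  have h1 := hf k
  have h2 := hf (k + 1)
  have h3 := hf (k + 2)
  have p1 := parityFactor_ne_zero hs k
  simp only [add_assoc, Nat.reduceAdd] at *
  rw [e2] at h
  field_simp at h
  linear_combination h

/-- The multiples of a point flow along the invariant vector field with proportional speed. -/
theorem deriv_of_relations (D : Derivation ℤ L L) {x a b : L} (hx : D x = 1) (ha : D a = 0)
    (hb : D b = 0) (hs : s = 4 * (x ^ 3 + a * x + b))
    (hc : c = 3 * x ^ 4 + 6 * a * x ^ 2 + 12 * b * x - a ^ 2) (hC : C = 6 * x ^ 2 + 2 * a)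
    (q : ℕ → L) (q1 : q 1 = 0) (q2 : s * q 2 = c) (hq : ∀ n, q (n + 2) ≠ 0) (h2 : (2 : L) ≠ 0)
    (hprod : ∀ k, q (k + 3) * q (k + 1) * q (k + 2) ^ 2 = s * q (k + 2) - c)
    (hsum : ∀ k, q (k + 2) ^ 2 * (q (k + 3) + q (k + 1)) = C * q (k + 2) - s) (n : ℕ) :
    s * D (q (n + 2)) = s - (n + 2) * (q (n + 2) ^ 2 * (q (n + 3) - q (n + 1))) := by
  have Dn (k : ℕ) (y : L) : D (OfNat.ofNat (k + 2) * y) = OfNat.ofNat (k + 2) * D y := by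
    rw [← Nat.cast_ofNat (R := L), ← nsmul_eq_mul, ← nsmul_eq_mul, map_nsmul]
  have D2 (y : L) : D (2 * y) = 2 * D y := Dn 0 y
  have D3 (y : L) : D (3 * y) = 3 * D y := Dn 1 y
  have D4 (y : L) : D (4 * y) = 4 * D y := Dn 2 y
  have D6 (y : L) : D (6 * y) = 6 * D y := Dn 4 y
  have D12 (y : L) : D (12 * y) = 12 * D y := Dn 10 y
  have Dsq (y : L) : D (y ^ 2) = 2 * y * D y := by
    rw [sq, D.leibniz]; simp only [smul_eq_mul]; ring
  have D3p (y : L) : D (y ^ 3) = 3 * y ^ 2 * D y := by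
    rw [pow_succ, D.leibniz, Dsq]; simp only [smul_eq_mul]; ring
  have D4p (y : L) : D (y ^ 4) = 4 * y ^ 3 * D y := by
    rw [pow_succ, D.leibniz, D3p]; simp only [smul_eq_mul]; ring
  have Dm (y z : L) : D (y * z) = y * D z + z * D y := D.leibniz y z
  have Ds : D s = 2 * C := by
    rw [hs, D4, map_add, map_add, D3p, Dm, hx, ha, hb, hC]; ring
  have Dc : D c = 3 * s := by
    rw [hc, map_sub, map_add, map_add, D3, D4p, Dm (6 * a), D6, Dm (12 * b), D12, Dsq, Dsq, hx, ha,
      hb, hs]; ring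
  have DC : D C = 12 * x := by
    rw [hC, map_add, D6, D2, Dsq, hx, ha]; ring
  have key : C ^ 2 + 4 * c = 12 * x * s := by rw [hC, hc, hs]; ring
  clear Dn
  -- With `N = n + 2`, the expression `C q - s - 2 q² q (n + 1)` stands for `4 y(P) y(NP)`. The two
  -- equations are the derivatives of `x(NP)` and `y(NP)` along `D`; they form a closed system, so
  -- the induction carries both.
  have main (n : ℕ) : s * D (q (n + 2)) =
        s - (n + 2) * (C * q (n + 2) - s - 2 * q (n + 2) ^ 2 * q (n + 1)) ∧
      s * D (C * q (n + 2) - s - 2 * q (n + 2) ^ 2 * q (n + 1)) =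
        C * (C * q (n + 2) - s - 2 * q (n + 2) ^ 2 * q (n + 1)) +
          2 * s * (n + 2) * (3 * (x - q (n + 2)) ^ 2 + a) := by
    induction n with
    | zero =>
      have h := congr_arg D q2
      rw [Dm, Ds, Dc] at h
      have h' : s * D (q 2) = s - 2 * (C * q 2 - s) := by linear_combination h
      refine ⟨by simpa [q1] using h', ?_⟩
      simp only [zero_add, q1, mul_zero, sub_zero, map_sub, Dm C, DC, Ds, Nat.cast_zero]
      rw [hC] at *
      linear_combination (6 * x ^ 2 + 2 * a) * h' + (-12 * q 2) * q2 - 3 * q 2 * key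
    | succ n ih =>
      obtain ⟨ih1, ih2⟩ := ih
      have S := hsum n
      have P := hprod n
      have hq := hq n
      simp only [show n + 1 + 1 = n + 2 by ring, show n + 1 + 2 = n + 3 by ring, Nat.cast_add,
        Nat.cast_one]
      generalize q (n + 1) = o at *
      generalize q (n + 2) = p at *
      generalize q (n + 3) = r at *
      have R : p ^ 2 * r ^ 2 - (C * p - s) * r + s * p - c = 0 := by
        linear_combination r * S - P
      have W : C * p - s - 2 * p ^ 2 * o = 2 * p ^ 2 * r - C * p + s := by
        linear_combination -2 * S
      rw [W] at ih1 ih2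
      have hD : D (2 * p ^ 2 * r - C * p + s) =
          2 * p ^ 2 * D r + 4 * p * r * D p - 12 * x * p - C * D p + 2 * C := by
        rw [map_add, map_sub, Dm, D2, Dsq, Dm, DC, Ds]; ring
      rw [hD] at ih2
      -- By `W` the second coordinate is linear in `r`, with coefficient `2 p² ≠ 0`, so its known
      -- derivative determines `D r`.
      have A : s * D r = s - (n + 1 + 2) * (C * r - s - 2 * r ^ 2 * p) := by
        refine mul_left_cancel₀ (mul_ne_zero h2 (pow_ne_zero 2 hq)) ?_
        linear_combination ih2 + (C - 4 * p * r) * ih1 + (n + 1) * (4 * p * R + p * key) -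
          (n + 2) * s * hC
      refine ⟨A, ?_⟩
      rw [map_sub, map_sub, Dm, Dm, D2, Dsq, DC, Ds]
      linear_combination (C - 4 * p * r) * A - 2 * r ^ 2 * ih1 - (n + 4) * (4 * r * R + r * key) +
        (n + 3) * s * hC
  rw [(main n).1]
  linear_combination (n + 2) * hsum n

/-- This is the flow equation with denominators cleared, arranged so that all terms without the
factor `f_{k+2}` stand apart: only these survive at a root of `f_{k+2}`. -/
theorem deriv_preNormEDS'_relation (D : Derivation ℤ L L) {x a b : L} (hx : D x = 1)
    (ha : D a = 0) (hb : D b = 0) (hs : s = 4 * (x ^ 3 + a * x + b))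
    (hc : c = 3 * x ^ 4 + 6 * a * x ^ 2 + 12 * b * x - a ^ 2) (hC : C = 6 * x ^ 2 + 2 * a)
    (hd : d = C * c - s ^ 2) (h2 : (2 : L) ≠ 0) (hs0 : s ≠ 0)
    (hf : ∀ n, preNormEDS' (s ^ 2) c d (n + 1) ≠ 0) (k : ℕ) :
    2 * (s * preNormEDS' (s ^ 2) c d (k + 3) * preNormEDS' (s ^ 2) c d (k + 1) *
        D (preNormEDS' (s ^ 2) c d (k + 2))) =
      (k + 2) * (preNormEDS' (s ^ 2) c d (k + 4) * preNormEDS' (s ^ 2) c d (k + 1) ^ 2 -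
        preNormEDS' (s ^ 2) c d k * preNormEDS' (s ^ 2) c d (k + 3) ^ 2) +
      preNormEDS' (s ^ 2) c d (k + 2) * ((if Even k then -1 else 1) * D s *
          preNormEDS' (s ^ 2) c d (k + 3) * preNormEDS' (s ^ 2) c d (k + 1) +
        s * (D (preNormEDS' (s ^ 2) c d (k + 3)) * preNormEDS' (s ^ 2) c d (k + 1) +
          preNormEDS' (s ^ 2) c d (k + 3) * D (preNormEDS' (s ^ 2) c d (k + 1))) -
        parityFactor s k ^ 2 * preNormEDS' (s ^ 2) c d (k + 2) ^ 2) := by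
  obtain ⟨hprod, hsum⟩ := xDiff_relations hs0 hf hd
  have h := deriv_of_relations D hx ha hb hs hc hC (xDiff s c d) xDiff_one
    (by rw [xDiff_two, mul_div_cancel₀ _ hs0]) (xDiff_ne_zero hs0 hf) h2 hprod hsum k
  have n1 := hf k
  have n2 := hf (k + 1)
  have n3 := hf (k + 2)
  clear hprod hsum hf hs hc hC hd
  simp only [xDiff_succ, parityFactor_add_two, add_assoc, Nat.reduceAdd] at *
  generalize preNormEDS' (s ^ 2) c d k = f0 at *
  generalize preNormEDS' (s ^ 2) c d (k + 1) = f1 at *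
  generalize preNormEDS' (s ^ 2) c d (k + 2) = f2 at *
  generalize preNormEDS' (s ^ 2) c d (k + 3) = f3 at *
  generalize preNormEDS' (s ^ 2) c d (k + 4) = f4 at *
  by_cases hk : Even k
  · simp only [parityFactor, hk, Nat.even_add_one, if_true, if_false, not_true_eq_false] at h ⊢
    simp only [Derivation.leibniz_div, Derivation.leibniz, Derivation.leibniz_pow, smul_eq_mul,
      nsmul_eq_mul, one_mul, Nat.cast_ofNat] at h ⊢
    field_simp at h
    refine mul_left_cancel₀ n2 ?_
    linear_combination -h
  · simp only [parityFactor, hk, Nat.even_add_one, if_true, if_false, not_false_eq_true] at h ⊢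
    simp only [Derivation.leibniz_div, Derivation.leibniz, Derivation.leibniz_pow, smul_eq_mul,
      nsmul_eq_mul, one_mul, Nat.cast_ofNat] at h ⊢
    field_simp at h
    refine mul_left_cancel₀ n2 ?_
    linear_combination -h

end

/-! ### Transfer to polynomials. -/

/-- The derivation of rational functions extending the derivative of polynomials. -/
theorem exists_derivation_fractionRing (K L : Type*) [Field K] [Field L] [Algebra K[X] L]
    [IsFractionRing K[X] L] :
    ∃ D : Derivation ℤ L L, ∀ p : K[X], D (algebraMap _ _ p) = algebraMap _ _ (derivative p) := by
  -- The map `p ↦ p + p' ε` into the dual numbers is a ring homomorphism sending nonzero polynomials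
  -- to units, so it extends to fractions; the `ε`-part of the extension is the derivation.
  let τ : K[X] →+* TrivSqZeroExt L L :=
    { toFun p := .inl (algebraMap _ L p) + .inr (algebraMap _ L (derivative p))
      map_one' := by ext <;> simp
      map_zero' := by ext <;> simp
      map_add' p q := by ext <;> simp [Algebra.smul_def]
      map_mul' p q := by ext <;> simp <;> simp only [Algebra.smul_def] <;> ring }
  have hτ (p : K[X]) : τ p = .inl (algebraMap _ L p) + .inr (algebraMap _ L (derivative p)) := rfl
  have hu (y : nonZeroDivisors K[X]) : IsUnit (τ y) := by
    rw [TrivSqZeroExt.isUnit_iff_isUnit_fst, hτ]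
    simp
  let σ : L →+* TrivSqZeroExt L L := IsLocalization.lift hu
  have hσ (p : K[X]) : σ (algebraMap _ L p) = τ p := IsLocalization.lift_eq hu p
  have hfst (z : L) : (σ z).fst = z := by
    have h : ((TrivSqZeroExt.fstHom L L L : TrivSqZeroExt L L →ₐ[L] L) :
        TrivSqZeroExt L L →+* L).comp σ = RingHom.id L := by
      refine IsLocalization.ringHom_ext (nonZeroDivisors K[X]) (RingHom.ext fun p => ?_)
      simp [hσ, hτ]
    exact RingHom.congr_fun h z
  refine ⟨Derivation.mk' (AddMonoidHom.toIntLinearMap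
    { toFun z := (σ z).snd, map_zero' := by simp, map_add' := by simp }) fun y z => ?_, fun p => ?_⟩
  · change (σ (y * z)).snd = y * (σ z).snd + z * (σ y).snd
    rw [map_mul, TrivSqZeroExt.snd_mul, hfst, hfst, smul_eq_mul, MulOpposite.smul_eq_mul_unop,
      MulOpposite.unop_op, mul_comm z]
  · change (σ (algebraMap _ L p)).snd = _
    rw [hσ, hτ]
    simp [← Algebra.algebraMap_eq_smul_one]

section
variable {R : Type*} [CommRing R] (a b : R)

theorem shortCurve_Ψ₂Sq :
    (shortCurve a b).Ψ₂Sq = 4 * (X ^ 3 + C a * X + C b) := by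
  simp only [WeierstrassCurve.Ψ₂Sq, shortCurve, WeierstrassCurve.b₂, WeierstrassCurve.b₄,
    WeierstrassCurve.b₆]
  simp only [map_add, map_mul, map_pow, map_zero, map_ofNat]
  ring

theorem shortCurve_Ψ₃ : (shortCurve a b).Ψ₃ =
    3 * X ^ 4 + 6 * C a * X ^ 2 + 12 * C b * X - C a ^ 2 := by
  simp only [WeierstrassCurve.Ψ₃, shortCurve, WeierstrassCurve.b₂, WeierstrassCurve.b₄,
    WeierstrassCurve.b₆, WeierstrassCurve.b₈]
  simp only [map_add, map_sub, map_mul, map_pow, map_zero, map_ofNat]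
  ring

theorem shortCurve_preΨ₄ : (shortCurve a b).preΨ₄ =
    (6 * X ^ 2 + 2 * C a) * (shortCurve a b).Ψ₃ - (shortCurve a b).Ψ₂Sq ^ 2 := by
  rw [shortCurve_Ψ₃, shortCurve_Ψ₂Sq]
  simp only [WeierstrassCurve.preΨ₄, shortCurve, WeierstrassCurve.b₂, WeierstrassCurve.b₄,
    WeierstrassCurve.b₆, WeierstrassCurve.b₈]
  simp only [map_add, map_sub, map_mul, map_pow, map_zero, map_ofNat]
  ring

theorem algebraMap_divisionPoly (L : Type*) [Field L] [Algebra R[X] L] (n : ℕ) :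
    algebraMap R[X] L (divisionPoly a b n) =
      preNormEDS' (algebraMap R[X] L (shortCurve a b).Ψ₂Sq ^ 2)
        (algebraMap R[X] L (shortCurve a b).Ψ₃) (algebraMap R[X] L (shortCurve a b).preΨ₄) n := by
  rw [divisionPoly, WeierstrassCurve.preΨ', map_preNormEDS', map_pow]

end

section
variable {K : Type*} [Field K] [CharZero K] (a b : K)

theorem divisionPoly_succ_ne_zero (n : ℕ) : divisionPoly a b (n + 1) ≠ 0 :=
  (shortCurve a b).preΨ'_ne_zero (Nat.cast_ne_zero.2 n.succ_ne_zero)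

theorem divisionPoly_invariant (k : ℕ) :
    divisionPoly a b (k + 4) * divisionPoly a b (k + 1) ^ 2 +
        divisionPoly a b k * divisionPoly a b (k + 3) ^ 2 +
        parityFactor (shortCurve a b).Ψ₂Sq k ^ 2 * divisionPoly a b (k + 2) ^ 3 =
      (6 * X ^ 2 + 2 * C a) * divisionPoly a b (k + 1) * divisionPoly a b (k + 2) *
        divisionPoly a b (k + 3) := by
  have inj := IsFractionRing.injective K[X] (FractionRing K[X])
  apply inj
  have hs : algebraMap K[X] (FractionRing K[X]) (shortCurve a b).Ψ₂Sq ≠ 0 :=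
    (map_ne_zero_iff _ inj).2 ((shortCurve a b).Ψ₂Sq_ne_zero (by norm_num))
  have h := preNormEDS'_invariant (L := FractionRing K[X])
    (C := algebraMap K[X] (FractionRing K[X]) (6 * X ^ 2 + 2 * C a)) hs
    (c := algebraMap K[X] (FractionRing K[X]) (shortCurve a b).Ψ₃)
    (d := algebraMap K[X] (FractionRing K[X]) (shortCurve a b).preΨ₄)
    (fun n => by
      rw [← algebraMap_divisionPoly]
      exact (map_ne_zero_iff _ inj).2 (divisionPoly_succ_ne_zero a b n))
    (by rw [shortCurve_preΨ₄]; simp only [map_sub, map_mul, map_pow]) k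
  simp only [← algebraMap_divisionPoly, ← map_parityFactor] at h
  simpa only [map_add, map_mul, map_pow] using h

/-- Only the class modulo `divisionPoly a b (k + 2)` is used later, hence the unspecified cofactor.
-/
theorem divisionPoly_derivative_relation (k : ℕ) :
    ∃ h : K[X], 2 * ((shortCurve a b).Ψ₂Sq * divisionPoly a b (k + 3) * divisionPoly a b (k + 1) *
        derivative (divisionPoly a b (k + 2))) =
      (k + 2) * (divisionPoly a b (k + 4) * divisionPoly a b (k + 1) ^ 2 -
        divisionPoly a b k * divisionPoly a b (k + 3) ^ 2) + divisionPoly a b (k + 2) * h := by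
  let L := FractionRing K[X]
  have inj : Function.Injective (algebraMap K[X] L) := IsFractionRing.injective K[X] L
  obtain ⟨D, hD⟩ := exists_derivation_fractionRing K L
  have h2 : (2 : L) ≠ 0 := by
    rw [← map_ofNat (algebraMap K[X] L)]
    exact (map_ne_zero_iff _ inj).2 two_ne_zero
  have h := deriv_preNormEDS'_relation D (x := algebraMap K[X] L X) (a := algebraMap K[X] L (C a))
    (b := algebraMap K[X] L (C b)) (s := algebraMap K[X] L (shortCurve a b).Ψ₂Sq)
    (c := algebraMap K[X] L (shortCurve a b).Ψ₃) (d := algebraMap K[X] L (shortCurve a b).preΨ₄)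
    (C := algebraMap K[X] L (6 * X ^ 2 + 2 * C a)) (by simp [hD]) (by simp [hD]) (by simp [hD])
    (by rw [shortCurve_Ψ₂Sq]; simp only [map_mul, map_add, map_pow, map_ofNat])
    (by rw [shortCurve_Ψ₃]; simp only [map_sub, map_mul, map_add, map_pow, map_ofNat])
    (by simp only [map_mul, map_add, map_pow, map_ofNat])
    (by rw [shortCurve_preΨ₄]; simp only [map_sub, map_mul, map_pow]) h2
    ((map_ne_zero_iff _ inj).2 ((shortCurve a b).Ψ₂Sq_ne_zero (by norm_num)))
    (fun n => by
      rw [← algebraMap_divisionPoly]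
      exact (map_ne_zero_iff _ inj).2 (divisionPoly_succ_ne_zero a b n)) k
  simp only [← algebraMap_divisionPoly, ← map_parityFactor, hD] at h
  refine ⟨(if Even k then -1 else 1) * derivative (shortCurve a b).Ψ₂Sq *
      divisionPoly a b (k + 3) * divisionPoly a b (k + 1) +
    (shortCurve a b).Ψ₂Sq * (derivative (divisionPoly a b (k + 3)) * divisionPoly a b (k + 1) +
      divisionPoly a b (k + 3) * derivative (divisionPoly a b (k + 1))) -
    parityFactor (shortCurve a b).Ψ₂Sq k ^ 2 * divisionPoly a b (k + 2) ^ 2, inj ?_⟩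
  simpa only [map_add, map_sub, map_mul, map_pow, map_neg, map_one, map_ofNat, map_natCast,
    apply_ite (algebraMap K[X] L)] using h
end

/-! ### Values at the points of order two. -/

section
variable {R : Type*} [CommRing R]

/-- These are the parameters at a root `e` of the cubic, where `ψ₂` vanishes and `h = 3e² + a`. One
term of each odd recursion then drops out and the sequence has a closed form. -/
theorem preNormEDS'_zero_left (h : R) (n : ℕ) :
    preNormEDS' 0 (-h ^ 2) (-2 * h ^ 3) (2 * n + 1) = (-1) ^ n * h ^ (n ^ 2 + n) ∧
    preNormEDS' 0 (-h ^ 2) (-2 * h ^ 3) (2 * n + 2) = (-1) ^ n * (n + 1) * h ^ (n ^ 2 + 2 * n) := by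
  have e1 (j : ℕ) : (-1 : R) ^ (j + 1) = -(-1) ^ j := by ring
  have e3 (j : ℕ) : (-1 : R) ^ (2 * j) = 1 := by simp
  induction n using Nat.strong_induction_on with
  | _ n ih =>
    match n, ih with
    | 0, _ => simp
    | 1, _ => exact ⟨by simp, by simp; ring⟩
    | n + 2, ih =>
      have odd : preNormEDS' 0 (-h ^ 2) (-2 * h ^ 3) (2 * (n + 2) + 1) =
          (-1) ^ (n + 2) * h ^ ((n + 2) ^ 2 + (n + 2)) := by
        rw [preNormEDS'_odd]
        rcases n.even_or_odd' with ⟨j, rfl | rfl⟩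
        · have h1 := (ih j (by lia)).1
          have h2 : preNormEDS' 0 (-h ^ 2) (-2 * h ^ 3) (2 * j + 3) = _ := (ih (j + 1) (by lia)).1
          simp only [even_two_mul, if_true, h1, h2, mul_zero, mul_one, e1, e3]
          rcases neg_one_pow_eq_or R j with hj | hj <;> rw [hj] <;> ring
        · have h1 : preNormEDS' 0 (-h ^ 2) (-2 * h ^ 3) (2 * j + 1 + 2) = _ :=
            (ih (j + 1) (by lia)).1
          have h2 : preNormEDS' 0 (-h ^ 2) (-2 * h ^ 3) (2 * j + 1 + 4) = _ :=
            (ih (j + 2) (by lia)).1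
          simp only [Nat.not_even_two_mul_add_one, if_false, h1, h2, mul_zero, mul_one, e1, e3]
          rcases neg_one_pow_eq_or R j with hj | hj <;> rw [hj] <;> ring
      refine ⟨mod_cast odd, ?_⟩
      -- The even case may need the odd value just proved: for `n = 0` it involves index `5 = 2 (n +
      -- 2) + 1`.
      have ih1 (i : ℕ) (hi : i ≤ n + 2) : preNormEDS' 0 (-h ^ 2) (-2 * h ^ 3) (2 * i + 1) =
          (-1) ^ i * h ^ (i ^ 2 + i) :=
        hi.lt_or_eq.elim (fun hi => (ih i hi).1) (fun hi => hi ▸ odd)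
      rw [show 2 * (n + 2) + 2 = 2 * (n + 3) by ring, preNormEDS'_even]
      rcases n.even_or_odd' with ⟨j, rfl | rfl⟩
      · have h1 := ih1 j (by lia)
        have h2 := (ih j (by lia)).2
        have h3 : preNormEDS' 0 (-h ^ 2) (-2 * h ^ 3) (2 * j + 3) = _ := ih1 (j + 1) (by lia)
        have h4 : preNormEDS' 0 (-h ^ 2) (-2 * h ^ 3) (2 * j + 4) = _ := (ih (j + 1) (by lia)).2
        have h5 : preNormEDS' 0 (-h ^ 2) (-2 * h ^ 3) (2 * j + 5) = _ := ih1 (j + 2) (by lia)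
        simp only [h1, h2, h3, h4, h5, e1, e3]
        push_cast
        rcases neg_one_pow_eq_or R j with hj | hj <;> rw [hj] <;> ring
      · have h1 : preNormEDS' 0 (-h ^ 2) (-2 * h ^ 3) (2 * j + 1 + 1) = _ := (ih j (by lia)).2
        have h2 : preNormEDS' 0 (-h ^ 2) (-2 * h ^ 3) (2 * j + 1 + 2) = _ := ih1 (j + 1) (by lia)
        have h3 : preNormEDS' 0 (-h ^ 2) (-2 * h ^ 3) (2 * j + 1 + 3) = _ :=
          (ih (j + 1) (by lia)).2
        have h4 : preNormEDS' 0 (-h ^ 2) (-2 * h ^ 3) (2 * j + 1 + 4) = _ := ih1 (j + 2) (by lia)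
        have h5 : preNormEDS' 0 (-h ^ 2) (-2 * h ^ 3) (2 * j + 1 + 5) = _ :=
          (ih (j + 2) (by lia)).2
        simp only [h1, h2, h3, h4, h5, e1, e3]
        push_cast
        rcases neg_one_pow_eq_or R j with hj | hj <;> rw [hj] <;> ring

end

/-! ### Products over roots, degrees and leading coefficients. -/

section
variable {K : Type*} [Field K]

/-- The product of the values of `G` at the roots of `F`. -/
noncomputable def rootProd (F G : K[X]) : K := (F.roots.map G.eval).prod

theorem rootProd_mul (F G H : K[X]) : rootProd F (G * H) = rootProd F G * rootProd F H := by
  simp [rootProd, Multiset.prod_map_mul]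

theorem rootProd_one (F : K[X]) : rootProd F 1 = 1 := by simp [rootProd]

theorem rootProd_pow (F G : K[X]) (n : ℕ) : rootProd F (G ^ n) = rootProd F G ^ n := by
  induction n with
  | zero => simp [rootProd_one]
  | succ n ih => rw [pow_succ, pow_succ, rootProd_mul, ih]

theorem rootProd_congr {F G H : K[X]} (h : ∀ x, F.eval x = 0 → G.eval x = H.eval x) :
    rootProd F G = rootProd F H := by
  unfold rootProd
  congr 1
  exact Multiset.map_congr rfl fun x hx => h x (isRoot_of_mem_roots hx)

section
variable [IsAlgClosed K]

theorem rootProd_C (F : K[X]) (c : K) : rootProd F (C c) = c ^ F.natDegree := by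
  simp [rootProd, ← splits_iff_card_roots.1 (IsAlgClosed.splits F)]

theorem rootProd_neg {F : K[X]} (hF : Even F.natDegree) (G : K[X]) :
    rootProd F (-G) = rootProd F G := by
  rw [← neg_one_mul, show (-1 : K[X]) = C (-1) by simp, rootProd_mul, rootProd_C, hF.neg_one_pow,
    one_mul]

theorem resultant_eq_rootProd (F G : K[X]) {n : ℕ} (hn : G.natDegree ≤ n) :
    resultant F G F.natDegree n = F.leadingCoeff ^ n * rootProd F G :=
  resultant_eq_prod_eval F G n hn (IsAlgClosed.splits F)

theorem rootProd_comm_of_even {F : K[X]} (hF : Even F.natDegree) (G : K[X]) :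
    F.leadingCoeff ^ G.natDegree * rootProd F G = G.leadingCoeff ^ F.natDegree * rootProd G F := by
  rw [← resultant_eq_rootProd F G le_rfl, ← resultant_eq_rootProd G F le_rfl, resultant_comm,
    (hF.mul_right _).neg_one_pow, one_mul]

end

section
variable [CharZero K] (a b : K)

theorem natDegree_divisionPoly_odd (j : ℕ) :
    (divisionPoly a b (2 * j + 1)).natDegree = 2 * j ^ 2 + 2 * j := by
  rw [divisionPoly, WeierstrassCurve.natDegree_preΨ' _ (Nat.cast_ne_zero.2 (by lia)),
    if_neg (Nat.not_even_two_mul_add_one j)]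
  have : (2 * j + 1) ^ 2 - 1 = 2 * (2 * j ^ 2 + 2 * j) := Nat.sub_eq_of_eq_add (by ring)
  lia

theorem natDegree_divisionPoly_even (j : ℕ) :
    (divisionPoly a b (2 * j + 2)).natDegree = 2 * j ^ 2 + 4 * j := by
  rw [divisionPoly, WeierstrassCurve.natDegree_preΨ' _ (Nat.cast_ne_zero.2 (by lia)),
    if_pos (by simp [Nat.even_add])]
  have : (2 * j + 2) ^ 2 - 4 = 2 * (2 * j ^ 2 + 4 * j) := Nat.sub_eq_of_eq_add (by ring)
  lia

theorem even_natDegree_divisionPoly (n : ℕ) : Even (divisionPoly a b (n + 1)).natDegree := by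
  rcases n.even_or_odd' with ⟨j, rfl | rfl⟩
  · rw [natDegree_divisionPoly_odd]; exact ⟨j ^ 2 + j, by ring⟩
  · rw [show 2 * j + 1 + 1 = 2 * j + 2 by ring, natDegree_divisionPoly_even]
    exact ⟨j ^ 2 + 2 * j, by ring⟩

theorem leadingCoeff_divisionPoly_odd (j : ℕ) :
    (divisionPoly a b (2 * j + 1)).leadingCoeff = 2 * j + 1 := by
  rw [divisionPoly, WeierstrassCurve.leadingCoeff_preΨ' _ (Nat.cast_ne_zero.2 (by lia)),
    if_neg (Nat.not_even_two_mul_add_one j)]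
  push_cast; rfl

theorem leadingCoeff_divisionPoly_even (j : ℕ) :
    (divisionPoly a b (2 * j + 2)).leadingCoeff = j + 1 := by
  rw [divisionPoly, WeierstrassCurve.leadingCoeff_preΨ' _ (Nat.cast_ne_zero.2 (by lia)),
    if_pos (by simp [Nat.even_add]), show (2 * j + 2) / 2 = j + 1 by lia]
  push_cast; rfl

end

theorem eval_divisionPoly_of_root (a b : K) {e : K} (he : e ^ 3 + a * e + b = 0) (n : ℕ) :
    (divisionPoly a b n).eval e =
      preNormEDS' 0 (-(3 * e ^ 2 + a) ^ 2) (-2 * (3 * e ^ 2 + a) ^ 3) n := by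
  have hs : (shortCurve a b).Ψ₂Sq.eval e = 0 := by
    rw [shortCurve_Ψ₂Sq]; simp [he]
  have h3 : (shortCurve a b).Ψ₃.eval e = -(3 * e ^ 2 + a) ^ 2 := by
    rw [shortCurve_Ψ₃]; simp; linear_combination 12 * e * he
  have h4 : (shortCurve a b).preΨ₄.eval e = -2 * (3 * e ^ 2 + a) ^ 3 := by
    rw [shortCurve_preΨ₄]; simp [hs, h3]; ring
  rw [divisionPoly, WeierstrassCurve.preΨ', ← coe_evalRingHom, map_preNormEDS', map_pow]
  simp only [coe_evalRingHom, hs, h3, h4]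
  simp

variable [IsAlgClosed K] [CharZero K] (a b : K)

theorem rootProd_cubic_derivative :
    rootProd (X ^ 3 + C a * X + C b) (3 * X ^ 2 + C a) = 4 * a ^ 3 + 27 * b ^ 2 := by
  have hdeg : (X ^ 3 + C a * X + C b : K[X]).degree = 3 := by compute_degree!
  have hnat : (X ^ 3 + C a * X + C b : K[X]).natDegree = 3 := natDegree_eq_of_degree_eq_some hdeg
  have hder : derivative (X ^ 3 + C a * X + C b : K[X]) = 3 * X ^ 2 + C a := by
    simp [show (C 2 + 1 : K[X]) = 3 by rw [map_ofNat]; norm_num]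
  have h := resultant_deriv (f := (X ^ 3 + C a * X + C b : K[X])) (by rw [hdeg]; norm_num)
  have hmon : (X ^ 3 + C a * X + C b : K[X]).leadingCoeff = 1 := by
    rw [leadingCoeff, hnat]; simp
  rw [resultant_eq_rootProd _ _ (by rw [hder, hnat]; compute_degree!), hder, hmon, hnat,
    discr_of_degree_eq_three hdeg] at h
  simp [coeff_X, coeff_C] at h
  rw [h]; ring

end

/-! ### Products over the roots of a division polynomial. -/

section
variable {K : Type*} [Field K] [IsAlgClosed K] [CharZero K] (a b : K)

/-- Symmetry of the resultant moves the product to the three roots of the cubic, where `F` is known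
and the values `3 e² + a` multiply to `4 a³ + 27 b²`. -/
theorem rootProd_Ψ₂Sq_left {F : K[X]} {G : K[X]} {σ : K} {n : ℕ}
    (h : ∀ e, e ^ 3 + a * e + b = 0 → F.eval e = σ * (3 * e ^ 2 + a) ^ n)
    (hF : Even F.natDegree) (hG : G = (shortCurve a b).Ψ₂Sq) :
    F.leadingCoeff ^ 3 * rootProd F G =
      4 ^ F.natDegree * (σ ^ 3 * (4 * a ^ 3 + 27 * b ^ 2) ^ n) := by
  have h4 : (4 : K) ≠ 0 := by norm_num
  have hcub : G = C 4 * (X ^ 3 + C a * X + C b) := by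
    rw [hG, shortCurve_Ψ₂Sq, map_ofNat]
  have hdeg : G.natDegree = 3 := by rw [hG]; exact WeierstrassCurve.natDegree_Ψ₂Sq _ h4
  have hlead : G.leadingCoeff = 4 := by rw [hG]; exact WeierstrassCurve.leadingCoeff_Ψ₂Sq _ h4
  have h1 := rootProd_comm_of_even hF G
  rw [hdeg, hlead] at h1
  rw [h1]
  congr 1
  rw [← rootProd_cubic_derivative, ← rootProd_pow]
  have h3 : σ ^ 3 = rootProd (X ^ 3 + C a * X + C b) (C σ) := by
    rw [rootProd_C, show (X ^ 3 + C a * X + C b : K[X]).natDegree = 3 by compute_degree!]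
  rw [h3, ← rootProd_mul]
  have h5 : rootProd G F = rootProd (X ^ 3 + C a * X + C b) F := by
    rw [rootProd, hcub, roots_C_mul _ h4, rootProd]
  rw [h5]
  refine rootProd_congr fun e he => ?_
  rw [h e (by simpa using he)]
  simp

theorem rootProd_divisionPoly_even_Ψ₂Sq (j : ℕ) :
    rootProd (divisionPoly a b (2 * j + 2)) (shortCurve a b).Ψ₂Sq =
      (-1) ^ j * (16 * (4 * a ^ 3 + 27 * b ^ 2)) ^ (j ^ 2 + 2 * j) := by
  have h := rootProd_Ψ₂Sq_left a b (F := divisionPoly a b (2 * j + 2))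
    (fun e he => (eval_divisionPoly_of_root a b he _).trans
      (preNormEDS'_zero_left (3 * e ^ 2 + a) j).2) (even_natDegree_divisionPoly a b _) rfl
  rw [leadingCoeff_divisionPoly_even, natDegree_divisionPoly_even] at h
  have hj : (j + 1 : K) ^ 3 ≠ 0 := pow_ne_zero 3 (by exact_mod_cast j.succ_ne_zero)
  refine mul_left_cancel₀ hj (h.trans ?_)
  rw [show 2 * j ^ 2 + 4 * j = 2 * (j ^ 2 + 2 * j) by ring, pow_mul,
    show (4 : K) ^ 2 = 16 by norm_num]
  generalize 4 * a ^ 3 + 27 * b ^ 2 = D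
  simp only [mul_pow]
  rcases neg_one_pow_eq_or K j with hj | hj <;> rw [hj] <;> ring

theorem rootProd_divisionPoly_odd_Ψ₂Sq (j : ℕ) :
    (2 * j + 1) ^ 3 * rootProd (divisionPoly a b (2 * j + 1)) (shortCurve a b).Ψ₂Sq =
      (-1) ^ j * (16 * (4 * a ^ 3 + 27 * b ^ 2)) ^ (j ^ 2 + j) := by
  have h := rootProd_Ψ₂Sq_left a b (F := divisionPoly a b (2 * j + 1))
    (fun e he => (eval_divisionPoly_of_root a b he _).trans
      (preNormEDS'_zero_left (3 * e ^ 2 + a) j).1) (even_natDegree_divisionPoly a b _) rfl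
  rw [leadingCoeff_divisionPoly_odd, natDegree_divisionPoly_odd] at h
  refine h.trans ?_
  rw [show 2 * j ^ 2 + 2 * j = 2 * (j ^ 2 + j) by ring, pow_mul,
    show (4 : K) ^ 2 = 16 by norm_num]
  generalize 4 * a ^ 3 + 27 * b ^ 2 = D
  simp only [mul_pow]
  rcases neg_one_pow_eq_or K j with hj | hj <;> rw [hj] <;> ring

/-- At a root of `f_{k+3}` the invariant has only two terms left; their relative sign disappears
because the degree is even. -/
theorem rootProd_step_succ (k : ℕ) :
    rootProd (divisionPoly a b (k + 3)) (divisionPoly a b (k + 4)) *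
      rootProd (divisionPoly a b (k + 3)) (divisionPoly a b (k + 1)) ^ 2 =
    rootProd (divisionPoly a b (k + 3)) (parityFactor (shortCurve a b).Ψ₂Sq k) ^ 2 *
      rootProd (divisionPoly a b (k + 3)) (divisionPoly a b (k + 2)) ^ 3 := by
  rw [← rootProd_pow, ← rootProd_mul, ← rootProd_pow, ← rootProd_pow, ← rootProd_mul,
    ← rootProd_neg (even_natDegree_divisionPoly a b _)]
  refine rootProd_congr fun x hx => ?_
  have h := congr_arg (eval x) (divisionPoly_invariant a b k)
  simp only [eval_add, eval_mul, eval_pow, hx] at h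
  simp only [eval_neg, eval_mul, eval_pow]
  linear_combination -h

theorem rootProd_step_add_two (k : ℕ) :
    rootProd (divisionPoly a b (k + 2)) (divisionPoly a b (k + 4)) *
      rootProd (divisionPoly a b (k + 2)) (divisionPoly a b (k + 1)) ^ 2 =
    rootProd (divisionPoly a b (k + 2)) (divisionPoly a b k) *
      rootProd (divisionPoly a b (k + 2)) (divisionPoly a b (k + 3)) ^ 2 := by
  rw [← rootProd_pow, ← rootProd_mul, ← rootProd_pow, ← rootProd_mul,
    ← rootProd_neg (even_natDegree_divisionPoly a b _)]
  refine rootProd_congr fun x hx => ?_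
  have h := congr_arg (eval x) (divisionPoly_invariant a b k)
  simp only [eval_add, eval_mul, eval_pow, hx] at h
  simp only [eval_neg, eval_mul, eval_pow]
  linear_combination -h

/-- At a root of `f_{k+2}` the invariant makes the two terms of the derivative relation opposite, so
they add up to `2 (k + 2) f_{k+4} f_{k+1}²`. One product of `f_{k+1}` is then cancelled. -/
theorem rootProd_derivative (k : ℕ)
    (h0 : rootProd (divisionPoly a b (k + 2)) (divisionPoly a b (k + 1)) ≠ 0) :
    rootProd (divisionPoly a b (k + 2)) (shortCurve a b).Ψ₂Sq *
      rootProd (divisionPoly a b (k + 2)) (divisionPoly a b (k + 3)) *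
      rootProd (divisionPoly a b (k + 2)) (derivative (divisionPoly a b (k + 2))) =
    (k + 2) ^ (divisionPoly a b (k + 2)).natDegree *
      rootProd (divisionPoly a b (k + 2)) (divisionPoly a b (k + 4)) *
      rootProd (divisionPoly a b (k + 2)) (divisionPoly a b (k + 1)) := by
  refine mul_right_cancel₀ h0 ?_
  rw [← rootProd_C]
  simp only [← rootProd_mul]
  refine rootProd_congr fun x hx => mul_left_cancel₀ (two_ne_zero (α := K)) ?_
  obtain ⟨w, hw⟩ := divisionPoly_derivative_relation a b k
  have h := congr_arg (eval x) (divisionPoly_invariant a b k)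
  have h' := congr_arg (eval x) hw
  simp only [eval_add, eval_mul, eval_pow, eval_sub, eval_ofNat, eval_natCast, hx] at h h'
  simp only [eval_mul, eval_C]
  linear_combination h' - (k + 2) * h

end

/-! ### Resultants of neighbouring division polynomials. -/

section
variable {K : Type*} [Field K]

theorem resultant_divisionPoly [IsAlgClosed K] (a b : K) (m n : ℕ) :
    resultant (divisionPoly a b m) (divisionPoly a b n) =
      (divisionPoly a b m).leadingCoeff ^ (divisionPoly a b n).natDegree *
        rootProd (divisionPoly a b m) (divisionPoly a b n) :=
  resultant_eq_rootProd _ _ le_rfl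

variable [CharZero K] (a b : K)

theorem resultant_divisionPoly_comm (m n : ℕ) :
    resultant (divisionPoly a b (m + 1)) (divisionPoly a b n) =
      resultant (divisionPoly a b n) (divisionPoly a b (m + 1)) := by
  rw [resultant_comm, ((even_natDegree_divisionPoly a b m).mul_right _).neg_one_pow, one_mul]

/-- This is the balance of leading-coefficient powers needed to pass from products over roots to
resultants. -/
theorem natDegree_divisionPoly_relation (k : ℕ) :
    (divisionPoly a b (k + 5)).natDegree + 2 * (divisionPoly a b (k + 2)).natDegree =
      (divisionPoly a b (k + 1)).natDegree + 2 * (divisionPoly a b (k + 4)).natDegree := by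
  rcases k.even_or_odd' with ⟨j, rfl | rfl⟩
  · have d1 : (divisionPoly a b (2 * j + 5)).natDegree = _ :=
      natDegree_divisionPoly_odd a b (j + 2)
    have d2 : (divisionPoly a b (2 * j + 4)).natDegree = _ :=
      natDegree_divisionPoly_even a b (j + 1)
    rw [d1, d2, natDegree_divisionPoly_odd, natDegree_divisionPoly_even]
    ring
  · have d1 : (divisionPoly a b (2 * j + 1 + 5)).natDegree = _ :=
      natDegree_divisionPoly_even a b (j + 2)
    have d2 : (divisionPoly a b (2 * j + 1 + 4)).natDegree = _ :=
      natDegree_divisionPoly_odd a b (j + 2)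
    have d3 : (divisionPoly a b (2 * j + 1 + 2)).natDegree = _ :=
      natDegree_divisionPoly_odd a b (j + 1)
    have d4 : (divisionPoly a b (2 * j + 1 + 1)).natDegree = _ :=
      natDegree_divisionPoly_even a b j
    rw [d1, d2, d3, d4]
    ring

variable [IsAlgClosed K]

theorem resultant_divisionPoly_odd_succ (j : ℕ) :
    resultant (divisionPoly a b (2 * j + 3)) (divisionPoly a b (2 * j + 4)) *
      resultant (divisionPoly a b (2 * j + 3)) (divisionPoly a b (2 * j + 1)) ^ 2 =
    ((16 * (4 * a ^ 3 + 27 * b ^ 2)) ^ (j ^ 2 + 3 * j + 2)) ^ 2 *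
      resultant (divisionPoly a b (2 * j + 3)) (divisionPoly a b (2 * j + 2)) ^ 3 := by
  have h := rootProd_step_succ a b (2 * j)
  have hp : parityFactor (shortCurve a b).Ψ₂Sq (2 * j) = (shortCurve a b).Ψ₂Sq := by
    simp [parityFactor]
  have hN := rootProd_divisionPoly_odd_Ψ₂Sq a b (j + 1)
  rw [show 2 * (j + 1) + 1 = 2 * j + 3 by ring] at hN
  rw [hp] at h
  simp only [resultant_divisionPoly]
  have hl : (divisionPoly a b (2 * j + 3)).leadingCoeff = 2 * ↑(j + 1) + 1 :=
    leadingCoeff_divisionPoly_odd a b (j + 1)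
  have d1 : (divisionPoly a b (2 * j + 4)).natDegree = _ := natDegree_divisionPoly_even a b (j + 1)
  rw [hl, d1, natDegree_divisionPoly_odd, natDegree_divisionPoly_even]
  have hN2 := congr_arg (· ^ 2) hN
  simp only [mul_pow _ _ 2, ← pow_mul (-1 : K)] at hN2
  rw [mul_comm (j + 1) 2, pow_mul (-1 : K), neg_one_sq, one_pow, one_mul,
    show (j + 1) ^ 2 + (j + 1) = j ^ 2 + 3 * j + 2 by ring] at hN2
  generalize (2 * ((j + 1 : ℕ) : K) + 1) = l at *
  rw [← hN2]
  linear_combination l ^ (6 * j ^ 2 + 12 * j + 6) * h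

theorem resultant_divisionPoly_even_succ (j : ℕ) :
    resultant (divisionPoly a b (2 * j + 4)) (divisionPoly a b (2 * j + 5)) *
      resultant (divisionPoly a b (2 * j + 4)) (divisionPoly a b (2 * j + 2)) ^ 2 =
      resultant (divisionPoly a b (2 * j + 4)) (divisionPoly a b (2 * j + 3)) ^ 3 := by
  have h := rootProd_step_succ a b (2 * j + 1)
  have hp : parityFactor (shortCurve a b).Ψ₂Sq (2 * j + 1) = 1 := by
    simp [parityFactor]
  rw [hp, rootProd_one, one_pow, one_mul] at h
  simp only [resultant_divisionPoly]
  have d1 : (divisionPoly a b (2 * j + 5)).natDegree = _ := natDegree_divisionPoly_odd a b (j + 2)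
  have d2 : (divisionPoly a b (2 * j + 3)).natDegree = _ := natDegree_divisionPoly_odd a b (j + 1)
  rw [d1, d2, natDegree_divisionPoly_even]
  generalize (divisionPoly a b (2 * j + 4)).leadingCoeff = l at *
  simp only [mul_pow]
  rw [← h]
  ring

theorem resultant_divisionPoly_add_two (k : ℕ) :
    resultant (divisionPoly a b (k + 3)) (divisionPoly a b (k + 5)) *
      resultant (divisionPoly a b (k + 3)) (divisionPoly a b (k + 2)) ^ 2 =
    resultant (divisionPoly a b (k + 3)) (divisionPoly a b (k + 1)) *
      resultant (divisionPoly a b (k + 3)) (divisionPoly a b (k + 4)) ^ 2 := by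
  have h := rootProd_step_add_two a b (k + 1)
  simp only [resultant_divisionPoly, show k + 1 + 2 = k + 3 by ring, show k + 1 + 4 = k + 5 by ring,
    show k + 1 + 1 = k + 2 by ring, show k + 1 + 3 = k + 4 by ring] at h ⊢
  have hd := natDegree_divisionPoly_relation a b k
  generalize (divisionPoly a b (k + 3)).leadingCoeff = l at *
  calc _ = l ^ ((divisionPoly a b (k + 5)).natDegree + 2 * (divisionPoly a b (k + 2)).natDegree) *
        (rootProd (divisionPoly a b (k + 3)) (divisionPoly a b (k + 5)) *
          rootProd (divisionPoly a b (k + 3)) (divisionPoly a b (k + 2)) ^ 2) := by ring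
    _ = _ := by rw [hd, h]; ring

/-- Resultants of coprime division polynomials are powers of the discriminant; here for indices
that differ by one or two. -/
theorem resultant_divisionPoly_eq_zpow (hE : 16 * (4 * a ^ 3 + 27 * b ^ 2) ≠ 0) (m : ℕ) :
    (∃ e : ℤ, 6 * e = (divisionPoly a b (m + 2)).natDegree * (divisionPoly a b (m + 3)).natDegree ∧
      resultant (divisionPoly a b (m + 2)) (divisionPoly a b (m + 3)) =
        (16 * (4 * a ^ 3 + 27 * b ^ 2)) ^ e) ∧
    (∃ e : ℤ, 6 * e = (divisionPoly a b (m + 1)).natDegree * (divisionPoly a b (m + 3)).natDegree ∧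
      resultant (divisionPoly a b (m + 1)) (divisionPoly a b (m + 3)) =
        (16 * (4 * a ^ 3 + 27 * b ^ 2)) ^ e) ∧
    (∃ e : ℤ, 6 * e = (divisionPoly a b (m + 2)).natDegree * (divisionPoly a b (m + 4)).natDegree ∧
      resultant (divisionPoly a b (m + 2)) (divisionPoly a b (m + 4)) =
        (16 * (4 * a ^ 3 + 27 * b ^ 2)) ^ e) := by
  set E := 16 * (4 * a ^ 3 + 27 * b ^ 2) with hE_def
  induction m with
  | zero =>
    have h1 : divisionPoly a b 1 = 1 := WeierstrassCurve.preΨ'_one _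
    have h2 : divisionPoly a b 2 = 1 := WeierstrassCurve.preΨ'_two _
    refine ⟨⟨0, ?_⟩, ⟨0, ?_⟩, ⟨0, ?_⟩⟩ <;> simp [h1, h2]
  | succ m ih =>
    obtain ⟨⟨u, hu, hU⟩, ⟨v, hv, hV⟩, ⟨w, hw, hW⟩⟩ := ih
    have succ : ∃ e : ℤ, 6 * e =
        (divisionPoly a b (m + 3)).natDegree * (divisionPoly a b (m + 4)).natDegree ∧
        resultant (divisionPoly a b (m + 3)) (divisionPoly a b (m + 4)) = E ^ e := by
      rcases m.even_or_odd' with ⟨j, rfl | rfl⟩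
      · have h := resultant_divisionPoly_odd_succ a b j
        rw [resultant_divisionPoly_comm a b (2 * j + 2) (2 * j + 1),
          resultant_divisionPoly_comm a b (2 * j + 2) (2 * j + 2), hU, hV, ← hE_def] at h
        -- The recursion divides by resultants, so exponents are integers at first; the equation for
        -- `6 * e` keeps track of their value.
        refine ⟨2 * (j ^ 2 + 3 * j + 2 : ℕ) + 3 * u - 2 * v, ?_, ?_⟩
        · have d3 : (divisionPoly a b (2 * j + 3)).natDegree = _ :=
            natDegree_divisionPoly_odd a b (j + 1)
          have d4 : (divisionPoly a b (2 * j + 4)).natDegree = _ :=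
            natDegree_divisionPoly_even a b (j + 1)
          rw [d3, natDegree_divisionPoly_odd] at hv
          rw [d3, natDegree_divisionPoly_even] at hu
          rw [d3, d4]
          push_cast at hu hv ⊢
          linear_combination 3 * hu - 2 * hv
        · rw [zpow_sub₀ hE, zpow_add₀ hE, mul_comm 2 v, mul_comm 3 u,
            mul_comm 2 ((j ^ 2 + 3 * j + 2 : ℕ) : ℤ), zpow_mul, zpow_mul, zpow_mul, zpow_natCast]
          exact eq_div_of_mul_eq (zpow_ne_zero 2 (zpow_ne_zero v hE)) (mod_cast h)
      · have h := resultant_divisionPoly_even_succ a b j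
        have e1 : resultant (divisionPoly a b (2 * j + 4)) (divisionPoly a b (2 * j + 3)) = E ^ u :=
          (resultant_divisionPoly_comm a b (2 * j + 3) (2 * j + 3)).trans hU
        have e2 : resultant (divisionPoly a b (2 * j + 4)) (divisionPoly a b (2 * j + 2)) = E ^ v :=
          (resultant_divisionPoly_comm a b (2 * j + 3) (2 * j + 2)).trans hV
        rw [e1, e2] at h
        refine ⟨3 * u - 2 * v, ?_, ?_⟩
        · have d2 : (divisionPoly a b (2 * j + 1 + 1)).natDegree = _ :=
            natDegree_divisionPoly_even a b j
          have d3 : (divisionPoly a b (2 * j + 1 + 2)).natDegree = _ :=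
            natDegree_divisionPoly_odd a b (j + 1)
          have d4 : (divisionPoly a b (2 * j + 1 + 3)).natDegree = _ :=
            natDegree_divisionPoly_even a b (j + 1)
          have d5 : (divisionPoly a b (2 * j + 1 + 4)).natDegree = _ :=
            natDegree_divisionPoly_odd a b (j + 2)
          rw [d2, d4] at hv
          rw [d3, d4] at hu
          rw [d4, d5]
          push_cast at hu hv ⊢
          linear_combination 3 * hu - 2 * hv
        · rw [zpow_sub₀ hE, mul_comm 3 u, mul_comm 2 v, zpow_mul, zpow_mul]
          exact eq_div_of_mul_eq (zpow_ne_zero 2 (zpow_ne_zero v hE)) (mod_cast h)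
    refine ⟨succ, ⟨w, hw, hW⟩, ?_⟩
    obtain ⟨x, hx, hX⟩ := succ
    have h := resultant_divisionPoly_add_two a b m
    rw [resultant_divisionPoly_comm a b (m + 2) (m + 2),
      resultant_divisionPoly_comm a b (m + 2) (m + 1), hU, hV, hX] at h
    refine ⟨v + 2 * x - 2 * u, ?_, ?_⟩
    · have hd : ((_ : ℕ) : ℤ) = (_ : ℕ) := congr_arg _ (natDegree_divisionPoly_relation a b m)
      push_cast at hd
      linear_combination hv + 2 * hx - 2 * hu - (divisionPoly a b (m + 3)).natDegree * hd
    · rw [zpow_sub₀ hE, zpow_add₀ hE, two_mul x, two_mul u, zpow_add₀ hE, zpow_add₀ hE, ← sq, ← sq]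
      exact eq_div_of_mul_eq (pow_ne_zero 2 (zpow_ne_zero u hE)) h
end

/-! ### Discriminants over an algebraically closed field. -/

section
variable {K : Type*} [Field K] [IsAlgClosed K] [CharZero K] (a b : K)

/-- For even `d`, the numbers `d (d - 1) / 2` and `d / 2` have the same parity. -/
theorem leadingCoeff_mul_discr_divisionPoly (n : ℕ) :
    (-1) ^ ((divisionPoly a b (n + 3)).natDegree / 2) * (divisionPoly a b (n + 3)).leadingCoeff *
        (divisionPoly a b (n + 3)).discr =
      (divisionPoly a b (n + 3)).leadingCoeff ^ ((divisionPoly a b (n + 3)).natDegree - 1) *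
        rootProd (divisionPoly a b (n + 3)) (derivative (divisionPoly a b (n + 3))) := by
  have hpos : 0 < (divisionPoly a b (n + 3)).natDegree :=
    WeierstrassCurve.natDegree_preΨ'_pos _ (by lia) (Nat.cast_ne_zero.2 (by lia))
  rw [← resultant_eq_rootProd _ _ (natDegree_derivative_le _),
    resultant_deriv (natDegree_pos_iff_degree_pos.1 hpos)]
  congr 2
  obtain ⟨d, hd⟩ := even_natDegree_divisionPoly a b (n + 2)
  rw [show n + 2 + 1 = n + 3 by ring] at hd
  rw [hd, ← two_mul, mul_assoc, Nat.mul_div_cancel_left _ two_pos,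
    Nat.mul_div_cancel_left _ two_pos,
    pow_mul]
  obtain ⟨d, rfl⟩ : ∃ i, d = i + 1 := ⟨d - 1, by lia⟩
  rw [show 2 * (d + 1) - 1 = 2 * d + 1 by lia]
  rcases neg_one_pow_eq_or K (d + 1) with h | h <;> rw [h] <;> simp [pow_add, pow_mul]

theorem discr_divisionPoly_even (hE : 16 * (4 * a ^ 3 + 27 * b ^ 2) ≠ 0) (j : ℕ) :
    ∃ e : ℤ, 24 * e = ((2 * j + 4) ^ 2 - 4) * ((2 * j + 4) ^ 2 - 6) ∧
      (divisionPoly a b (2 * j + 4)).discr =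
        2 ^ 4 * (2 * j + 4) ^ (2 * j ^ 2 + 8 * j + 2) * (16 * (4 * a ^ 3 + 27 * b ^ 2)) ^ e := by
  obtain ⟨⟨u, hu, hU⟩, -, ⟨v, hv, hV⟩⟩ := resultant_divisionPoly_eq_zpow a b hE (2 * j + 2)
  obtain ⟨⟨w, hw, hW⟩, -, -⟩ := resultant_divisionPoly_eq_zpow a b hE (2 * j + 1)
  have hS := rootProd_divisionPoly_even_Ψ₂Sq a b (j + 1)
  have hdisc := leadingCoeff_mul_discr_divisionPoly a b (2 * j + 1)
  have hder := rootProd_derivative a b (2 * j + 2)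
  simp only [show 2 * j + 1 + 3 = 2 * j + 4 by ring, show 2 * j + 2 + 3 = 2 * j + 5 by ring,
    show 2 * j + 2 + 4 = 2 * j + 6 by ring,
    show 2 * j + 1 + 2 = 2 * j + 3 by ring, show 2 * (j + 1) + 2 = 2 * j + 4 by ring] at *
  have l4 : (divisionPoly a b (2 * j + 4)).leadingCoeff = _ :=
    leadingCoeff_divisionPoly_even a b (j + 1)
  have d3 : (divisionPoly a b (2 * j + 3)).natDegree = _ := natDegree_divisionPoly_odd a b (j + 1)
  have d4 : (divisionPoly a b (2 * j + 4)).natDegree = _ := natDegree_divisionPoly_even a b (j + 1)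
  have d5 : (divisionPoly a b (2 * j + 5)).natDegree = _ := natDegree_divisionPoly_odd a b (j + 2)
  have d6 : (divisionPoly a b (2 * j + 6)).natDegree = _ := natDegree_divisionPoly_even a b (j + 2)
  have hW' := resultant_divisionPoly_comm a b (2 * j + 3) (2 * j + 3)
  rw [show 2 * j + 3 + 1 = 2 * j + 4 by ring, hW] at hW'
  rw [resultant_divisionPoly, l4, d5] at hU
  rw [resultant_divisionPoly, l4, d6] at hV
  rw [resultant_divisionPoly, l4, d3] at hW'
  rw [d4, l4, show (2 * (j + 1) ^ 2 + 4 * (j + 1)) / 2 = j ^ 2 + 4 * j + 3 by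
    rw [show 2 * (j + 1) ^ 2 + 4 * (j + 1) = 2 * (j ^ 2 + 4 * j + 3) by ring]; simp,
    show 2 * (j + 1) ^ 2 + 4 * (j + 1) - 1 = 2 * j ^ 2 + 8 * j + 5 from
      Nat.sub_eq_of_eq_add (by ring)] at hdisc
  -- The same sign occurs in `hS`, so the two cancel.
  have hsign : (-1 : K) ^ (j ^ 2 + 4 * j + 3) = (-1) ^ (j + 1) := by
    rw [show j ^ 2 + 4 * j + 3 = (j + 1) * (j + 3) by ring, pow_mul]
    rcases neg_one_pow_eq_or K (j + 1) with h | h <;> rw [h]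
    · simp
    · rw [show j + 3 = j + 1 + 2 by ring, pow_add, h]
      simp
  rw [hsign] at hdisc
  rw [d3, d4] at hw
  rw [d4, d5] at hu
  rw [d4, d6] at hv
  push_cast at hw hu hv hder
  rw [d4, hS] at hder
  generalize 16 * (4 * a ^ 3 + 27 * b ^ 2) = E at *
  have hder := hder (right_ne_zero_of_mul (hW'.trans_ne (zpow_ne_zero w hE)))
  have hl : ((j + 1 : ℕ) + 1 : K) ≠ 0 := by exact_mod_cast (j + 1).succ_ne_zero
  -- Read off from `hder`: `v` and `w` come from the neighbours on the right, `u` and the last term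
  -- from the neighbour and `Ψ₂Sq` on the left.
  refine ⟨v + w - u - (j ^ 2 + 4 * j + 3 : ℕ), ?_, ?_⟩
  · push_cast
    linear_combination 4 * hv + 4 * hw - 4 * hu
  · rw [zpow_sub₀ hE, zpow_sub₀ hE, zpow_add₀ hE, zpow_natCast, div_div, ← mul_div_assoc]
    refine eq_div_of_mul_eq (mul_ne_zero (zpow_ne_zero _ hE) (pow_ne_zero _ hE))
      (mul_left_cancel₀ (pow_ne_zero 4 hl) ?_)
    rw [← hU, ← hV, ← hW']
    have hσ : ((-1 : K) ^ (j + 1)) ^ 2 = 1 := by rw [← pow_mul, mul_comm, pow_mul]; simp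
    -- The leading coefficient is `m / 2` and enters with exponent `-4` overall; this produces the
    -- constant `2 ^ 4` and lowers the exponent of `m` by four.
    have hm : (2 * j + 4 : K) ^ 4 = 16 * ((j + 1 : ℕ) + 1 : K) ^ 4 := by push_cast; ring
    rw [show (2 * j + 2 + 2 : K) = 2 * j + 4 by ring] at hder
    generalize (2 * j + 4 : K) = m at *
    generalize ((j + 1 : ℕ) + 1 : K) = l at *
    generalize (-1 : K) ^ (j + 1) = σ at *
    generalize rootProd (divisionPoly a b (2 * j + 4)) (divisionPoly a b (2 * j + 3)) = N3 at *
    generalize rootProd (divisionPoly a b (2 * j + 4)) (divisionPoly a b (2 * j + 5)) = N5 at *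
    generalize rootProd (divisionPoly a b (2 * j + 4)) (divisionPoly a b (2 * j + 6)) = N6 at *
    linear_combination (l ^ 3 * σ * E ^ (j ^ 2 + 4 * j + 3) * l ^ (2 * j ^ 2 + 10 * j + 12) * N5) *
      hdisc + l ^ (4 * j ^ 2 + 18 * j + 20) * hder -
      (l ^ 4 * (divisionPoly a b (2 * j + 4)).discr * E ^ (j ^ 2 + 4 * j + 3) *
        l ^ (2 * j ^ 2 + 10 * j + 12) * N5) * hσ +
      (l ^ (4 * j ^ 2 + 18 * j + 20) * m ^ (2 * j ^ 2 + 8 * j + 2) * N6 * N3) * hm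

theorem discr_divisionPoly_odd (hE : 16 * (4 * a ^ 3 + 27 * b ^ 2) ≠ 0) (j : ℕ) :
    ∃ e : ℤ, 24 * e = ((2 * j + 3) ^ 2 - 1) * ((2 * j + 3) ^ 2 - 3) ∧
      (divisionPoly a b (2 * j + 3)).discr =
        (-1) ^ (j + 1) * (2 * j + 3) ^ (2 * j ^ 2 + 6 * j + 3) *
          (16 * (4 * a ^ 3 + 27 * b ^ 2)) ^ e := by
  obtain ⟨⟨u, hu, hU⟩, -, ⟨v, hv, hV⟩⟩ := resultant_divisionPoly_eq_zpow a b hE (2 * j + 1)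
  obtain ⟨⟨w, hw, hW⟩, -, -⟩ := resultant_divisionPoly_eq_zpow a b hE (2 * j)
  have hS := rootProd_divisionPoly_odd_Ψ₂Sq a b (j + 1)
  have hdisc := leadingCoeff_mul_discr_divisionPoly a b (2 * j)
  have hder := rootProd_derivative a b (2 * j + 1)
  simp only [show 2 * j + 1 + 3 = 2 * j + 4 by ring, show 2 * j + 1 + 4 = 2 * j + 5 by ring,
    show 2 * j + 1 + 2 = 2 * j + 3 by ring, show 2 * j + 1 + 1 = 2 * j + 2 by ring,
    show 2 * (j + 1) + 1 = 2 * j + 3 by ring] at *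
  have l3 : (divisionPoly a b (2 * j + 3)).leadingCoeff = _ :=
    leadingCoeff_divisionPoly_odd a b (j + 1)
  have d2 : (divisionPoly a b (2 * j + 2)).natDegree = _ := natDegree_divisionPoly_even a b j
  have d3 : (divisionPoly a b (2 * j + 3)).natDegree = _ := natDegree_divisionPoly_odd a b (j + 1)
  have d4 : (divisionPoly a b (2 * j + 4)).natDegree = _ := natDegree_divisionPoly_even a b (j + 1)
  have d5 : (divisionPoly a b (2 * j + 5)).natDegree = _ := natDegree_divisionPoly_odd a b (j + 2)
  have hW' := resultant_divisionPoly_comm a b (2 * j + 2) (2 * j + 2)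
  rw [show 2 * j + 2 + 1 = 2 * j + 3 by ring, hW] at hW'
  rw [resultant_divisionPoly, l3, d4] at hU
  rw [resultant_divisionPoly, l3, d5] at hV
  rw [resultant_divisionPoly, l3, d2] at hW'
  -- Here the degree is divisible by four, so the sign in `hS` survives in the result.
  have hsign : (-1 : K) ^ ((2 * (j + 1) ^ 2 + 2 * (j + 1)) / 2) = 1 := by
    rw [show 2 * (j + 1) ^ 2 + 2 * (j + 1) = 2 * ((j + 1) * (j + 1 + 1)) by ring,
      Nat.mul_div_cancel_left _ two_pos, (Nat.even_mul_succ_self (j + 1)).neg_one_pow]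
  rw [d3, l3, hsign, one_mul, show 2 * (j + 1) ^ 2 + 2 * (j + 1) - 1 = 2 * j ^ 2 + 6 * j + 3 from
      Nat.sub_eq_of_eq_add (by ring)] at hdisc
  rw [d2, d3] at hw
  rw [d3, d4] at hu
  rw [d3, d5] at hv
  push_cast at hw hu hv hder hS hU hV hW' hdisc
  rw [d3] at hder
  generalize 16 * (4 * a ^ 3 + 27 * b ^ 2) = E at *
  have hder := hder (right_ne_zero_of_mul (hW'.trans_ne (zpow_ne_zero w hE)))
  have hl : (2 * j + 3 : K) ≠ 0 := by exact_mod_cast (2 * j + 2).succ_ne_zero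
  refine ⟨v + w - u - (j ^ 2 + 3 * j + 2 : ℕ), ?_, ?_⟩
  · push_cast
    linear_combination 4 * hv + 4 * hw - 4 * hu
  · rw [zpow_sub₀ hE, zpow_sub₀ hE, zpow_add₀ hE, zpow_natCast, div_div, ← mul_div_assoc]
    refine eq_div_of_mul_eq (mul_ne_zero (zpow_ne_zero _ hE) (pow_ne_zero _ hE))
      (mul_left_cancel₀ hl ?_)
    rw [← hU, ← hV, ← hW']
    have hσ : ((-1 : K) ^ (j + 1)) ^ 2 = 1 := by rw [← pow_mul, mul_comm, pow_mul]; simp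
    rw [show (2 * (j + 1) + 1 : K) = 2 * j + 3 by ring] at *
    rw [show (2 * j + 1 + 2 : K) = 2 * j + 3 by ring] at hder
    generalize (2 * j + 3 : K) = m at *
    generalize (-1 : K) ^ (j + 1) = σ at *
    generalize rootProd (divisionPoly a b (2 * j + 3)) (divisionPoly a b (2 * j + 2)) = N2 at *
    generalize rootProd (divisionPoly a b (2 * j + 3)) (divisionPoly a b (2 * j + 4)) = N4 at *
    generalize rootProd (divisionPoly a b (2 * j + 3)) (divisionPoly a b (2 * j + 5)) = N5 at *
    generalize rootProd (divisionPoly a b (2 * j + 3)) (shortCurve a b).Ψ₂Sq = S at *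
    generalize rootProd (divisionPoly a b (2 * j + 3))
      (derivative (divisionPoly a b (2 * j + 3))) = N' at *
    linear_combination (E ^ (j ^ 2 + 3 * j + 2) * m ^ (2 * j ^ 2 + 8 * j + 6) * N4) * hdisc -
      m ^ (4 * j ^ 2 + 14 * j + 9) * N' * N4 * σ * hS -
      m ^ (4 * j ^ 2 + 14 * j + 9) * N' * N4 * E ^ (j ^ 2 + 3 * j + 2) * hσ +
      σ * m ^ (4 * j ^ 2 + 14 * j + 12) * hder
end

/-! ### Discriminants under base change. -/

namespace Polynomial

variable {R S : Type*} [CommRing R] [CommRing S]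

/-- The matrix `sylvesterDeriv`, for a polynomial regarded as having degree `n`. -/
noncomputable def sylvesterDerivOfDegree (f : R[X]) (n : ℕ) :
    Matrix (Fin (n - 1 + n)) (Fin (n - 1 + n)) R :=
  if hn : n = 0 then 0
  else (f.derivative.sylvester f (n - 1) n).updateRow ⟨2 * n - 2, by lia⟩
    (fun j ↦ if ↑j = n - 2 then 1 else (if ↑j = 2 * n - 2 then n else 0))

theorem discr_eq_det_sylvesterDerivOfDegree {f : R[X]} {n : ℕ} (h : f.natDegree = n) :
    f.discr = (f.sylvesterDerivOfDegree n).det * (-1) ^ (n * (n - 1) / 2) := by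
  subst h
  rfl

theorem map_sylvesterDerivOfDegree (φ : R →+* S) (f : R[X]) (n : ℕ) :
    (f.map φ).sylvesterDerivOfDegree n = φ.mapMatrix (f.sylvesterDerivOfDegree n) := by
  unfold sylvesterDerivOfDegree
  split_ifs with h
  · simp
  · rw [derivative_map, sylvester_map_map]
    ext i j
    simp only [RingHom.mapMatrix_apply, Matrix.updateRow_apply, Matrix.map_apply]
    split_ifs <;> simp

/-- The size of the matrix defining `discr` depends on the degree; once that is fixed, its entries
are mapped one by one. -/
theorem discr_map_of_natDegree_eq (φ : R →+* S) {f : R[X]}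
    (h : (f.map φ).natDegree = f.natDegree) : (f.map φ).discr = φ f.discr := by
  rw [discr_eq_det_sylvesterDerivOfDegree h, discr_eq_det_sylvesterDerivOfDegree (f := f) rfl,
    map_sylvesterDerivOfDegree, ← RingHom.map_det, map_mul, map_pow, map_neg, map_one]

end Polynomial

/-! ### The universal formula and specialisation. -/

section
variable {R S : Type*} [CommRing R] [CommRing S]

theorem divisionPoly_map (φ : R →+* S) (a b : R) (n : ℕ) :
    (divisionPoly a b n).map φ = divisionPoly (φ a) (φ b) n := by
  rw [divisionPoly, ← WeierstrassCurve.map_preΨ', divisionPoly]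
  congr 1
  ext <;> simp [shortCurve]

/-- Nonvanishing of `n` in both rings prevents the leading coefficient, `n` or `n / 2`, from
vanishing. -/
theorem discr_divisionPoly_map (φ : R →+* S) (a b : R) {n : ℕ} (hR : (n : R) ≠ 0)
    (hS : (n : S) ≠ 0) : (divisionPoly (φ a) (φ b) n).discr = φ (divisionPoly a b n).discr := by
  rw [← divisionPoly_map]
  refine discr_map_of_natDegree_eq φ ?_
  rw [divisionPoly_map, divisionPoly, divisionPoly, WeierstrassCurve.natDegree_preΨ' _ hS,
    WeierstrassCurve.natDegree_preΨ' _ hR]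

theorem neg_shortCurve_Δ (a b : R) : -(shortCurve a b).Δ = 16 * (4 * a ^ 3 + 27 * b ^ 2) := by
  rw [shortCurve_disc]; ring

/-- The asserted value of the discriminant of the `m`-th division polynomial. -/
def DiscrFormula (a b : R) (m : ℕ) : Prop :=
  (Even m → 4 ≤ m → (divisionPoly a b m).discr =
      2 ^ 4 * (m : R) ^ ((m ^ 2 - 12) / 2) *
        (-(shortCurve a b).Δ) ^ ((m ^ 2 - 4) * (m ^ 2 - 6) / 24)) ∧
    (Odd m → 3 ≤ m → (divisionPoly a b m).discr =
      (-1) ^ ((m - 1) / 2) * (m : R) ^ ((m ^ 2 - 3) / 2) *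
        (-(shortCurve a b).Δ) ^ ((m ^ 2 - 1) * (m ^ 2 - 3) / 24))

theorem discrFormula_of_isAlgClosed {K : Type*} [Field K] [IsAlgClosed K] [CharZero K] {a b : K}
    (hΔ : (shortCurve a b).Δ ≠ 0) (m : ℕ) : DiscrFormula a b m := by
  have hE : 16 * (4 * a ^ 3 + 27 * b ^ 2) ≠ 0 := by rwa [← neg_shortCurve_Δ, neg_ne_zero]
  refine ⟨fun hm hm4 => ?_, fun hm hm3 => ?_⟩ <;> rw [neg_shortCurve_Δ]
  · obtain ⟨j, rfl⟩ : ∃ j, m = 2 * j + 4 := by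
      obtain ⟨k, rfl⟩ := hm.two_dvd
      exact ⟨k - 2, by lia⟩
    obtain ⟨e, he, h⟩ := discr_divisionPoly_even a b hE j
    have h12 : (2 * j + 4) ^ 2 - 12 = 2 * (2 * j ^ 2 + 8 * j + 2) := Nat.sub_eq_of_eq_add (by ring)
    have h4 : (2 * j + 4) ^ 2 - 4 = 4 * j ^ 2 + 16 * j + 12 := Nat.sub_eq_of_eq_add (by ring)
    have h6 : (2 * j + 4) ^ 2 - 6 = 4 * j ^ 2 + 16 * j + 10 := Nat.sub_eq_of_eq_add (by ring)
    have he' : e = (((2 * j + 4) ^ 2 - 4) * ((2 * j + 4) ^ 2 - 6) / 24 : ℕ) := by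
      rw [h4, h6, Int.natCast_ediv]
      refine (Int.ediv_eq_of_eq_mul_right (by norm_num) ?_).symm
      push_cast
      rw [he]; ring
    rw [h, h12, Nat.mul_div_cancel_left _ two_pos, he', zpow_natCast]
    push_cast
    rfl
  · obtain ⟨j, rfl⟩ : ∃ j, m = 2 * j + 3 := by
      obtain ⟨k, rfl⟩ := hm
      exact ⟨k - 1, by lia⟩
    obtain ⟨e, he, h⟩ := discr_divisionPoly_odd a b hE j
    have h1 : (2 * j + 3) ^ 2 - 1 = 4 * j ^ 2 + 12 * j + 8 := Nat.sub_eq_of_eq_add (by ring)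
    have h3 : (2 * j + 3) ^ 2 - 3 = 2 * (2 * j ^ 2 + 6 * j + 3) := Nat.sub_eq_of_eq_add (by ring)
    have he' : e = (((2 * j + 3) ^ 2 - 1) * ((2 * j + 3) ^ 2 - 3) / 24 : ℕ) := by
      rw [h1, h3, Int.natCast_ediv]
      refine (Int.ediv_eq_of_eq_mul_right (by norm_num) ?_).symm
      push_cast
      rw [he]; ring
    rw [h, he', zpow_natCast, h3, Nat.mul_div_cancel_left _ two_pos,
      show (2 * j + 3 - 1) / 2 = j + 1 by lia]
    push_cast
    rfl

theorem DiscrFormula.map (φ : R →+* S) {a b : R} {m : ℕ} (hR : (m : R) ≠ 0) (hS : (m : S) ≠ 0)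
    (h : DiscrFormula a b m) : DiscrFormula (φ a) (φ b) m := by
  refine ⟨fun h1 h2 => ?_, fun h1 h2 => ?_⟩
  · rw [discr_divisionPoly_map φ a b hR hS, h.1 h1 h2]
    simp only [neg_shortCurve_Δ, map_mul, map_pow, map_add, map_natCast, map_ofNat]
  · rw [discr_divisionPoly_map φ a b hR hS, h.2 h1 h2]
    simp only [neg_shortCurve_Δ, map_mul, map_pow, map_add, map_neg, map_one, map_natCast,
      map_ofNat]

theorem DiscrFormula.of_injective {φ : R →+* S} (hφ : Function.Injective φ) {a b : R} {m : ℕ}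
    (hR : (m : R) ≠ 0) (h : DiscrFormula (φ a) (φ b) m) : DiscrFormula a b m := by
  have hS : (m : S) ≠ 0 := by rwa [← map_natCast φ, map_ne_zero_iff φ hφ]
  refine ⟨fun h1 h2 => hφ ?_, fun h1 h2 => hφ ?_⟩
  · rw [← discr_divisionPoly_map φ a b hR hS, h.1 h1 h2]
    simp only [neg_shortCurve_Δ, map_mul, map_pow, map_add, map_natCast, map_ofNat]
  · rw [← discr_divisionPoly_map φ a b hR hS, h.2 h1 h2]
    simp only [neg_shortCurve_Δ, map_mul, map_pow, map_add, map_neg, map_one, map_natCast,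
      map_ofNat]

/-- For indeterminate coefficients the ring is a domain of characteristic 0 with `Δ ≠ 0`, so it
embeds in a field where division by powers of `Δ` is allowed. -/
theorem discrFormula_universal {m : ℕ} (hm : m ≠ 0) :
    DiscrFormula (MvPolynomial.X 0 : MvPolynomial (Fin 2) ℤ) (MvPolynomial.X 1) m := by
  let U := MvPolynomial (Fin 2) ℤ
  let K := AlgebraicClosure (FractionRing U)
  have hinj : Function.Injective (algebraMap U K) := by
    rw [IsScalarTower.algebraMap_eq U (FractionRing U) K]
    exact (algebraMap (FractionRing U) K).injective.comp (IsFractionRing.injective U _)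
  have : CharZero K := charZero_of_injective_ringHom hinj
  refine .of_injective hinj (by exact_mod_cast hm) (discrFormula_of_isAlgClosed ?_ m)
  rw [← neg_ne_zero, neg_shortCurve_Δ]
  have h : (16 * (4 * MvPolynomial.X 0 ^ 3 + 27 * MvPolynomial.X 1 ^ 2) : U) ≠ 0 := fun h => by
    -- At `a = 1`, `b = 0` the value is `64`.
    simpa using congr_arg (MvPolynomial.eval ![1, 0]) h
  simpa only [map_mul, map_add, map_pow, map_ofNat] using (map_ne_zero_iff _ hinj).2 h

end

theorem mainTheorem5 {R : Type*} [CommRing R] (a b : R) (m : ℕ) (hm : (m : R) ≠ 0) :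
    (Even m → 4 ≤ m →
      (divisionPoly a b m).discr =
        2 ^ 4 * (m : R) ^ ((m ^ 2 - 12) / 2) *
          (-(shortCurve a b).Δ) ^ ((m ^ 2 - 4) * (m ^ 2 - 6) / 24)) ∧
    (Odd m → 3 ≤ m →
      (divisionPoly a b m).discr =
        (-1) ^ ((m - 1) / 2) * (m : R) ^ ((m ^ 2 - 3) / 2) *
          (-(shortCurve a b).Δ) ^ ((m ^ 2 - 1) * (m ^ 2 - 3) / 24)) := by
  have hm0 : m ≠ 0 := by rintro rfl; simp at hm
  have h := (discrFormula_universal hm0).map (MvPolynomial.aeval ![a, b]).toRingHom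
    (by exact_mod_cast hm0) hm
  simpa [DiscrFormula] using h
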